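/- **Definitions.** Let $n\ge 1$ and let $P(z;x,y)=\sum_{k=0}^n F_{n-k}(x,y)z^k\in\mathbb C[x,y,z]$ have degree at most $n$ in each of $x,y,z$, with $F_0(0,0)=1$. For $x,y\in\mathbb C$ with $F_0(x,y)\ne 0$ let $x*y$ be the $n$-multiset of roots of $P(z;x,y)$ in $z$. The polynomial $P$ defines an *$n$-algebraic $n$-valued group* on $\mathbb C$ if: (identity) $P(z;0,y)=F_0(0,y)(z-y)^n$ and $P(z;x,0)=F_0(x,0)(z-x)^n$; (inverse) there is a polynomial map $\mathrm{inv}:\mathbb C\to\mathbb C$ with $F_n(x,\mathrm{inv}(x))=F_n(\mathrm{inv}(x),x)=0$ for all $x$; (associativity) the $n^2$-multisets $[w*z\mid w\in x*y]$ and $[x*w\mid w\in y*z]$ coincide whenever all products involved are defined. It is *symmetric* if $P(z;(-1)^nx,(-1)^ny)$ is symmetric in $x,y,z$. Let $\sigma_1,\sigma_2,\sigma_3$ be the elementary symmetric polynomials in $x,y,z$. The homogeneous $n$-component $P^{\mathrm h}$ of $P$ is the sum of its monomials of total degree $n$ in $x,y,z$. For a group $G$ and a finite group $H$ of automorphisms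 of $G$ with orbit map $\pi:G\to G/H$, the *coset group* is the set $G/H$ with the multiplication $\pi(u)*\pi(v)=[\pi(u\,h(v))\mid h\in H]$. **Theorem.** If $P$ defines a symmetric 3-algebraic 3-valued group, then $P(z;-x,-y)$ has the form $$\sigma_1^3+k_0\sigma_3+k_6\sigma_3^2+k_{12}\sigma_3^3+k_2\sigma_1\sigma_3+k_4\sigma_2\sigma_3+\ell_6\sigma_1\sigma_2\sigma_3+\ell_4\sigma_1^2\sigma_3+k_8\sigma_2^2\sigma_3+\ell_8\sigma_3^2\sigma_1+k_{10}\sigma_3^2\sigma_2$$ with complex coefficients, and $k_0\in\{-27,0\}$. Moreover: (i) A polynomial $P$ of this form with $k_0=-27$ defines a symmetric 3-algebraic 3-valued group if and only if, for some $c\in\mathbb C$, $$P(z;-x,-y)=\sigma_1^3-27\sigma_3+18c\,\sigma_1^2\sigma_3-54c\,\sigma_2\sigma_3-27c^2\sigma_2^2\sigma_3+81c^2\sigma_1\sigma_3^2 .$$ In this case $P^{\mathrm h}(z;-x,-y)=\sigma_1^3-27\sigma_3$, which is the law of the everywhere defined multiplication $x*y=[(\sqrt[3]{x}+\epsilon^r\sqrt[3]{y})^3\mid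 r=1,2,3]$ on $\mathbb C$, where $\epsilon=e^{2\pi i/3}$. Furthermore, let $E_c$ be the group of nonsingular points (with the point at infinity as zero) of the curve $y^2=x^3+c$. Then $\tau(x,y)=(\epsilon x,y)$ defines an automorphism of $E_c$ of order 3, and $(x,y)\mapsto 1/y$ (with the point at infinity sent to $0$, and points with $y=0$ sent to $\infty$) induces an injection $\psi:E_c/\langle\tau\rangle\to\mathbb C\cup\{\infty\}$, with image $\mathbb C\cup\{\infty\}$ if $c\ne0$ and $\mathbb C$ if $c=0$. For orbits $a,b$ with $\psi(a)=u\in\mathbb C$ and $\psi(b)=v\in\mathbb C$, the product of $u$ and $v$ under the law $P$ is defined (that is, $F_0(u,v)\neq0$) if and only if the product $a*b$ in the coset group $E_c/\langle\tau\rangle$ contains no orbit with $\psi=\infty$, and then $\psi$ maps the multiset $a*b$ to $u*v$. (ii) A polynomial $P$ of this form with $k_0=0$ defines a symmetric 3-algebraic 3-valued group if and only if, for some $\alpha\in\mathbb C$, $$P(z;-x,-y)=(\sigma_1+\alpha\sigma_3)^3 .$$ In this case $P^{\mathrm h}(z;-x,-y)=\sigma_1^3$. The polynomial $P_1$ with $P_1(z;-x,-y)=\sigma_1+\alpha\sigma_3$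 defines a symmetric 1-algebraic 1-valued group, with $x*y=\frac{x+y}{1+\alpha xy}$, and the 3-valued group is its diagonal: the two multiplications have the same domain of definition, and if the product of $x$ and $y$ under $P_1$ is $w$, then under $P$ it is $[w,w,w]$. -/

import Mathlib

open MvPolynomial

noncomputable section

namespace NValued

/-! ### Multiplication laws on `ℂ` given by a polynomial

A polynomial `P(z; x, y)` is an element of `ℂ[X 0, X 1, X 2]` with `X 0 = x`, `X 1 = y`,
`X 2 = z`. -/

/-- The polynomial `P(z; x, y)` in the variable `z`, for fixed complex numbers `x` and `y`. -/
def slice (P : MvPolynomial (Fin 3) ℂ) (x y : ℂ) : Polynomial ℂ :=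
  aeval ![Polynomial.C x, Polynomial.C y, Polynomial.X] P

/-- The coefficient `F_j(x, y)` in `P(z; x, y) = ∑ k, F_{n-k}(x, y) z^k`. -/
def F (n : ℕ) (P : MvPolynomial (Fin 3) ℂ) (j : ℕ) (x y : ℂ) : ℂ :=
  (slice P x y).coeff (n - j)

/-- The product `x * y`: the multiset of the roots of `P(z; x, y)` in `z`. It has `n` elements
when `P` has degree at most `n` in `z` and `F_0(x, y) ≠ 0`. -/
def rootMul (P : MvPolynomial (Fin 3) ℂ) (x y : ℂ) : Multiset ℂ :=
  (slice P x y).roots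

/-- `P` defines an `n`-algebraic `n`-valued group on `ℂ`: the partially defined multiplication
sends `(x, y)` with `F_0(x, y) ≠ 0` to the `n`-multiset of the roots of `P(z; x, y)`. -/
structure IsAlgebraicGroup (n : ℕ) (P : MvPolynomial (Fin 3) ℂ) : Prop where
  degree_le : ∀ i, P.degreeOf i ≤ n
  normalized : F n P 0 0 0 = 1
  /-- `P(z; 0, y) = F_0(0, y) (z - y)^n`. -/
  zero_mul : ∀ y, slice P 0 y =
    Polynomial.C (F n P 0 0 y) * (Polynomial.X - Polynomial.C y) ^ n
  /-- `P(z; x, 0) = F_0(x, 0) (z - x)^n`. -/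
  mul_zero : ∀ x, slice P x 0 =
    Polynomial.C (F n P 0 x 0) * (Polynomial.X - Polynomial.C x) ^ n
  /-- There is an algebraic map `inv : ℂ → ℂ` with `F_n(x, inv x) = F_n(inv x, x) = 0`. -/
  exists_inv : ∃ inv : Polynomial ℂ, ∀ x,
    F n P n x (inv.eval x) = 0 ∧ F n P n (inv.eval x) x = 0
  /-- The `n^2`-multisets `[w * z | w ∈ x * y]` and `[x * w | w ∈ y * z]` coincide, whenever
  all the products that occur are defined. -/
  assoc : ∀ x y z, F n P 0 x y ≠ 0 → F n P 0 y z ≠ 0 →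
    (∀ w ∈ rootMul P x y, F n P 0 w z ≠ 0) → (∀ w ∈ rootMul P y z, F n P 0 x w ≠ 0) →
    (rootMul P x y).bind (fun w => rootMul P w z) =
      (rootMul P y z).bind (fun w => rootMul P x w)

/-- The polynomial `P(z; (-1)^n x, (-1)^n y)`. -/
def twist (n : ℕ) (P : MvPolynomial (Fin 3) ℂ) : MvPolynomial (Fin 3) ℂ :=
  aeval ![C ((-1) ^ n) * X 0, C ((-1) ^ n) * X 1, X 2] P

/-- `P` defines a symmetric `n`-algebraic `n`-valued group. -/
def IsSymmetricAlgebraicGroup (n : ℕ) (P : MvPolynomial (Fin 3) ℂ) : Prop :=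
  IsAlgebraicGroup n P ∧ (twist n P).IsSymmetric

/-- The elementary symmetric polynomials in `x, y, z`. -/
abbrev σ (i : ℕ) : MvPolynomial (Fin 3) ℂ := esymm (Fin 3) ℂ i

/-- The general form of `P(z; -x, -y)` for `n = 3`, with ten undetermined coefficients. -/
def generalForm (k₀ k₂ k₄ k₆ k₈ k₁₀ k₁₂ l₄ l₆ l₈ : ℂ) : MvPolynomial (Fin 3) ℂ :=
  σ 1 ^ 3 + C k₀ * σ 3 + C k₆ * σ 3 ^ 2 + C k₁₂ * σ 3 ^ 3 + C k₂ * σ 1 * σ 3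
    + C k₄ * σ 2 * σ 3 + C l₆ * σ 1 * σ 2 * σ 3 + C l₄ * σ 1 ^ 2 * σ 3
    + C k₈ * σ 2 ^ 2 * σ 3 + C l₈ * σ 3 ^ 2 * σ 1 + C k₁₀ * σ 3 ^ 2 * σ 2

/-- The law of the first class, with parameter `c`. -/
def lawElliptic (c : ℂ) : MvPolynomial (Fin 3) ℂ :=
  σ 1 ^ 3 - 27 * σ 3 + C (18 * c) * σ 1 ^ 2 * σ 3 - C (54 * c) * σ 2 * σ 3
    - C (27 * c ^ 2) * σ 2 ^ 2 * σ 3 + C (81 * c ^ 2) * σ 1 * σ 3 ^ 2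

/-- The law of the second class, with parameter `α`. -/
def lawDiagonal (α : ℂ) : MvPolynomial (Fin 3) ℂ :=
  (σ 1 + C α * σ 3) ^ 3

/-- The multiplication `x * y = [(x^(1/n) + ε^r y^(1/n))^n | r = 1, …, n]` of the group `𝔾_n`,
with `ε = exp (2πi/n)` and the principal branch of the root. -/
def groupGMul (n : ℕ) (x y : ℂ) : Multiset ℂ :=
  (Finset.Icc 1 n).val.map fun r : ℕ =>
    (x ^ (1 / n : ℂ) + Complex.exp (2 * Real.pi * Complex.I / n) ^ r * y ^ (1 / n : ℂ)) ^ n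

/-! ### The coset construction -/

section Coset

variable {G : Type*} [Group G] (H : Subgroup (MulAut G)) [Finite H]

/-- The `|H|`-valued multiplication `π(u) * π(v) = [π(u · h(v)) | h ∈ H]` on the set of orbits of
a finite group `H` of automorphisms of `G`. -/
def cosetMul : MulAction.orbitRel.Quotient H G → MulAction.orbitRel.Quotient H G →
    Multiset (MulAction.orbitRel.Quotient H G) :=
  letI : Fintype H := Fintype.ofFinite H
  Quotient.lift₂
    (fun u v => (Finset.univ : Finset H).val.map fun h =>
      (Quotient.mk (MulAction.orbitRel H G) (u * h.1 v) : MulAction.orbitRel.Quotient H G))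
    (by
      rintro u₁ v₁ u₂ v₂ ⟨g, rfl⟩ ⟨k, rfl⟩
      refine Multiset.map_eq_map_of_bij_of_nodup _ _ Finset.univ.nodup Finset.univ.nodup
        (fun h _ => g⁻¹ * h * k) (fun _ _ => Finset.mem_univ _)
        (fun a _ b _ hab => by simpa using hab)
        (fun b _ => ⟨g * b * k⁻¹, Finset.mem_univ _, by group⟩)
        (fun h _ => Quotient.sound ⟨g, ?_⟩)
      have e : ∀ (a : H) (m : G), a • m = a.1 m := fun _ _ => rfl
      simp [e, MulAut.mul_apply])

end Coset

/-! ### The curve `y² = x³ + c` -/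

/-- The Weierstrass curve `y² = x³ + c`. Its type `(curve c).Point` of nonsingular points,
with the point at infinity as zero, carries the chord-tangent addition of Mathlib. -/
def curve (c : ℂ) : WeierstrassCurve.Affine ℂ := ⟨0, 0, 0, 0, c⟩

/-- The map `(x, y) ↦ 1 / y` from the curve to the projective line `ℂ ∪ {∞}`; it sends the point
at infinity to `0` and points with `y = 0` to `∞`. -/
def invY (c : ℂ) : (curve c).Point → OnePoint ℂ
  | .zero => ((0 : ℂ) : OnePoint ℂ)
  | .some _ y _ => if y = 0 then OnePoint.infty else ((y⁻¹ : ℂ) : OnePoint ℂ)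

end NValued

end

noncomputable section

namespace NValued

theorem twist_monomial (n : ℕ) (m : Fin 3 →₀ ℕ) (a : ℂ) :
    twist n (monomial m a) = monomial m ((-1) ^ (n * (m 0 + m 1)) * a) := by
  rw [twist, aeval_monomial, Finsupp.prod_fintype _ _ (by simp), Fin.prod_univ_three,
    monomial_eq, Finsupp.prod_fintype _ _ (by simp), Fin.prod_univ_three]
  simp only [Matrix.cons_val_zero, Matrix.cons_val_one, Matrix.cons_val, algebraMap_eq, mul_pow,
    C_mul, C_pow, C_neg, C_1, mul_add, pow_add, pow_mul]
  ring

theorem coeff_twist (n : ℕ) (P : MvPolynomial (Fin 3) ℂ) (m : Fin 3 →₀ ℕ) :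
    coeff m (twist n P) = (-1) ^ (n * (m 0 + m 1)) * coeff m P := by
  induction P using MvPolynomial.induction_on' with
  | monomial u a =>
    rw [twist_monomial, coeff_monomial, coeff_monomial]
    split_ifs with h
    · rw [h]
    · simp
  | add p q hp hq =>
    have : twist n (p + q) = twist n p + twist n q := by simp [twist]
    rw [this, coeff_add, coeff_add, hp, hq]; ring

theorem support_twist (n : ℕ) (P : MvPolynomial (Fin 3) ℂ) :
    (twist n P).support = P.support := by
  ext m
  simp [mem_support_iff, coeff_twist]

theorem degreeOf_twist (n : ℕ) (P : MvPolynomial (Fin 3) ℂ) (i : Fin 3) :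
    degreeOf i (twist n P) = degreeOf i P := by
  simp only [degreeOf_eq_sup, support_twist]

theorem homogeneousComponent_twist (n d : ℕ) (P : MvPolynomial (Fin 3) ℂ) :
    twist n (homogeneousComponent d P) = homogeneousComponent d (twist n P) := by
  ext m
  simp only [coeff_twist, coeff_homogeneousComponent]
  split_ifs <;> simp

theorem eval_twist (n : ℕ) (P : MvPolynomial (Fin 3) ℂ) (x y z : ℂ) :
    eval ![x, y, z] (twist n P) = eval ![(-1) ^ n * x, (-1) ^ n * y, z] P := by
  rw [twist, ← MvPolynomial.coe_aeval_eq_eval, ← MvPolynomial.coe_aeval_eq_eval]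
  simp only [RingHom.coe_coe]
  rw [← AlgHom.comp_apply, comp_aeval]
  congr 2
  ext i
  fin_cases i <;> simp

theorem eval_slice (P : MvPolynomial (Fin 3) ℂ) (x y z : ℂ) :
    (slice P x y).eval z = eval ![x, y, z] P := by
  rw [slice, ← Polynomial.coe_aeval_eq_eval, ← MvPolynomial.coe_aeval_eq_eval]
  simp only [RingHom.coe_coe]
  change ((Polynomial.aeval z).comp (aeval _)) P = _
  rw [comp_aeval]
  congr 2
  ext i
  fin_cases i <;> simp

theorem eval_slice_three (P : MvPolynomial (Fin 3) ℂ) (x y z : ℂ) :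
    (slice P x y).eval z = eval ![-x, -y, z] (twist 3 P) := by
  rw [eval_slice, eval_twist]
  norm_num

theorem eval_slice_one (P : MvPolynomial (Fin 3) ℂ) (x y z : ℂ) :
    (slice P x y).eval z = eval ![-x, -y, z] (twist 1 P) := by
  rw [eval_slice, eval_twist]
  norm_num

theorem sigma_one : σ 1 = X 0 + X 1 + X 2 := by
  simp [σ, MvPolynomial.esymm_one, Fin.sum_univ_three]

theorem sigma_two : σ 2 = X 0 * X 1 + X 0 * X 2 + X 1 * X 2 := by
  have : Finset.powersetCard 2 (Finset.univ : Finset (Fin 3)) = {{0, 1}, {0, 2}, {1, 2}} := by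
    decide
  rw [σ, esymm, this, Finset.sum_insert (by decide), Finset.sum_insert (by decide),
    Finset.sum_singleton, Finset.prod_pair (by decide), Finset.prod_pair (by decide),
    Finset.prod_pair (by decide)]
  ring

theorem sigma_three : σ 3 = X 0 * X 1 * X 2 := by
  have : Finset.powersetCard 3 (Finset.univ : Finset (Fin 3)) = {Finset.univ} := by
    decide
  rw [σ, esymm, this, Finset.sum_singleton, Fin.prod_univ_three]

theorem eval_sigma_one (x y z : ℂ) : eval ![x, y, z] (σ 1) = x + y + z := by
  rw [sigma_one]; simp

theorem eval_sigma_two (x y z : ℂ) : eval ![x, y, z] (σ 2) = x * y + x * z + y * z := by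
  rw [sigma_two]; simp

theorem eval_sigma_three (x y z : ℂ) : eval ![x, y, z] (σ 3) = x * y * z := by
  rw [sigma_three]; simp

theorem ext_eval {p q : MvPolynomial (Fin 3) ℂ}
    (h : ∀ x y z : ℂ, eval ![x, y, z] p = eval ![x, y, z] q) : p = q := by
  refine MvPolynomial.funext fun v => ?_
  have : v = ![v 0, v 1, v 2] := by
    ext i; fin_cases i <;> rfl
  rw [this]
  exact h _ _ _

theorem eval_generalForm (k₀ k₂ k₄ k₆ k₈ k₁₀ k₁₂ l₄ l₆ l₈ x y z : ℂ) :
    eval ![x, y, z] (generalForm k₀ k₂ k₄ k₆ k₈ k₁₀ k₁₂ l₄ l₆ l₈) =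
      (x + y + z) ^ 3 + x * y * z * (k₀ + k₂ * (x + y + z) + k₄ * (x * y + x * z + y * z)
        + k₆ * (x * y * z) + l₄ * (x + y + z) ^ 2 + l₆ * (x + y + z) * (x * y + x * z + y * z)
        + k₈ * (x * y + x * z + y * z) ^ 2 + l₈ * (x * y * z) * (x + y + z)
        + k₁₀ * (x * y * z) * (x * y + x * z + y * z) + k₁₂ * (x * y * z) ^ 2) := by
  simp only [generalForm, map_add, map_mul, map_pow, eval_C, eval_sigma_one, eval_sigma_two,
    eval_sigma_three]
  ring

/-- The exponent vector of `x^i y^j z^k`. -/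
def expo (i j k : ℕ) : Fin 3 →₀ ℕ := Finsupp.equivFunOnFinite.symm ![i, j, k]

theorem eval_eq_sum_range {p : MvPolynomial (Fin 3) ℂ} {n : ℕ} (h : ∀ i, p.degreeOf i ≤ n)
    (x y z : ℂ) :
    eval ![x, y, z] p = ∑ i ∈ Finset.range (n + 1), ∑ j ∈ Finset.range (n + 1),
      ∑ k ∈ Finset.range (n + 1), coeff (expo i j k) p * (x ^ i * y ^ j * z ^ k) := by
  have hinj : ∀ a b : ℕ × ℕ × ℕ, expo a.1 a.2.1 a.2.2 = expo b.1 b.2.1 b.2.2 → a = b := by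
    rintro ⟨i, j, k⟩ ⟨i', j', k'⟩ e
    have e' := Finsupp.equivFunOnFinite.symm.injective e
    simpa using ⟨congrFun e' 0, congrFun e' 1, congrFun e' 2⟩
  rw [eval_eq']
  simp only [Fin.prod_univ_three]
  rw [Finset.sum_subset (s₂ := ((Finset.range (n + 1) ×ˢ Finset.range (n + 1)) ×ˢ
      Finset.range (n + 1)).image fun a => expo a.1.1 a.1.2 a.2)]
  · rw [Finset.sum_image, Finset.sum_product, Finset.sum_product]
    · rfl
    · rintro ⟨⟨i, j⟩, k⟩ _ ⟨⟨i', j'⟩, k'⟩ _ e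
      have := hinj (i, j, k) (i', j', k') e
      simp_all
  · intro d hd
    refine Finset.mem_image.2 ⟨((d 0, d 1), d 2), ?_, ?_⟩
    · simp only [Finset.mem_product, Finset.mem_range]
      have := fun i => (monomial_le_degreeOf i hd).trans (h i)
      exact ⟨⟨Nat.lt_succ_of_le (this 0), Nat.lt_succ_of_le (this 1)⟩,
        Nat.lt_succ_of_le (this 2)⟩
    · ext i
      fin_cases i <;> rfl
  · intro d _ hd
    simp [notMem_support_iff.1 hd]

theorem coeff_expo_swap {p : MvPolynomial (Fin 3) ℂ} (hp : p.IsSymmetric) (i j k : ℕ) :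
    coeff (expo i j k) p = coeff (expo j i k) p := by
  have h := coeff_rename_mapDomain (Equiv.swap (0 : Fin 3) 1) (Equiv.injective _) p (expo j i k)
  rw [hp] at h
  rw [← h, ← Finsupp.equivMapDomain_eq_mapDomain]
  congr 1
  ext a
  fin_cases a <;> simp [expo, Finsupp.equivMapDomain_apply, Equiv.swap_apply_def]

theorem coeff_expo_swap' {p : MvPolynomial (Fin 3) ℂ} (hp : p.IsSymmetric) (i j k : ℕ) :
    coeff (expo i j k) p = coeff (expo i k j) p := by
  have h := coeff_rename_mapDomain (Equiv.swap (1 : Fin 3) 2) (Equiv.injective _) p (expo i k j)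
  rw [hp] at h
  rw [← h, ← Finsupp.equivMapDomain_eq_mapDomain]
  congr 1
  ext a
  fin_cases a <;> simp [expo, Finsupp.equivMapDomain_apply, Equiv.swap_apply_def]

theorem eval_swap {p : MvPolynomial (Fin 3) ℂ} (hp : p.IsSymmetric) (x y z : ℂ) :
    eval ![x, y, z] p = eval ![x, z, y] p := by
  conv_rhs => rw [← hp (Equiv.swap 1 2), eval_rename]
  congr 2
  ext a
  fin_cases a <;> simp [Equiv.swap_apply_def]

theorem cubic_coeffs_eq_zero {a b c d : ℂ} (h : ∀ z : ℂ, a + b * z + c * z ^ 2 + d * z ^ 3 = 0) :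
    a = 0 ∧ b = 0 ∧ c = 0 ∧ d = 0 := by
  have h0 := h 0
  have h1 := h 1
  have h2 := h (-1)
  have h3 := h 2
  refine ⟨?_, ?_, ?_, ?_⟩
  · linear_combination h0
  · linear_combination (-1 / 2 : ℂ) * h0 + h1 - h2 / 3 - h3 / 6
  · linear_combination -h0 + h1 / 2 + h2 / 2
  · linear_combination h0 / 2 - h1 / 2 - h2 / 6 + h3 / 6

/-- A symmetric polynomial with `p(0, y, z) = (y + z)^3` and degree at most `3` in each
variable. -/
theorem exists_eq_generalForm {p : MvPolynomial (Fin 3) ℂ} (hp : p.IsSymmetric)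
    (hd : ∀ i, p.degreeOf i ≤ 3) (h0 : ∀ y z : ℂ, eval ![0, y, z] p = (y + z) ^ 3) :
    ∃ k₀ k₂ k₄ k₆ k₈ k₁₀ k₁₂ l₄ l₆ l₈ : ℂ,
      p = generalForm k₀ k₂ k₄ k₆ k₈ k₁₀ k₁₂ l₄ l₆ l₈ := by
  obtain ⟨b, hb⟩ : ∃ b : ℕ → ℕ → ℕ → ℂ, ∀ i j k, b i j k = coeff (expo i j k) p :=
    ⟨_, fun _ _ _ => rfl⟩
  have hs : ∀ i j k, b i j k = b j i k := fun i j k => by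
    rw [hb, hb, coeff_expo_swap hp]
  have hs' : ∀ i j k, b i j k = b i k j := fun i j k => by
    rw [hb, hb, coeff_expo_swap' hp]
  have he := eval_eq_sum_range hd
  simp only [← hb, Finset.sum_range_succ, Finset.sum_range_zero, zero_add, Nat.reduceAdd] at he
  have hz : ∀ y : ℂ, _ := fun y => cubic_coeffs_eq_zero (a := b 0 0 0 + b 0 1 0 * y
      + b 0 2 0 * y ^ 2 + (b 0 3 0 - 1) * y ^ 3)
    (b := b 0 0 1 + b 0 1 1 * y + (b 0 2 1 - 3) * y ^ 2 + b 0 3 1 * y ^ 3)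
    (c := b 0 0 2 + (b 0 1 2 - 3) * y + b 0 2 2 * y ^ 2 + b 0 3 2 * y ^ 3)
    (d := (b 0 0 3 - 1) + b 0 1 3 * y + b 0 2 3 * y ^ 2 + b 0 3 3 * y ^ 3)
    fun z => by linear_combination h0 y z - he 0 y z
  obtain ⟨z1, -, -, -⟩ := cubic_coeffs_eq_zero fun y => (hz y).1
  obtain ⟨z2, z3, -, z4⟩ := cubic_coeffs_eq_zero fun y => (hz y).2.1
  obtain ⟨z5, z6, z7, z8⟩ := cubic_coeffs_eq_zero fun y => (hz y).2.2.1
  obtain ⟨z9, -, -, z10⟩ := cubic_coeffs_eq_zero fun y => (hz y).2.2.2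
  refine ⟨b 1 1 1 - 6, b 1 1 2, b 1 2 2 - 2 * b 1 1 3, b 2 2 2 - 3 * b 1 2 3, b 1 3 3, b 2 3 3,
    b 3 3 3, b 1 1 3, b 1 2 3, b 2 2 3 - 2 * b 1 3 3, ext_eval fun x y z => ?_⟩
  rw [eval_generalForm, he]
  simp only [hs, hs'] at z1 z2 z3 z4 z5 z6 z7 z8 z9 z10 ⊢
  rw [sub_eq_zero] at z6 z9
  simp only [z1, z2, z3, z4, z5, z6, z7, z8, z9, z10]
  ring

/-! ### Associativity as a symmetry of a resultant -/

section Resultant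

variable {R S : Type*} [CommRing R] [CommRing S]

/-- The resultant of the cubic polynomials `∑ fᵢ wⁱ` and `∑ gᵢ wⁱ`, as a Bezout determinant. -/
def cubicRes (f₀ f₁ f₂ f₃ g₀ g₁ g₂ g₃ : R) : R :=
  (f₁ * g₀ - f₀ * g₁) * ((f₃ * g₀ - f₀ * g₃ + (f₂ * g₁ - f₁ * g₂)) * (f₃ * g₂ - f₂ * g₃)
      - (f₃ * g₁ - f₁ * g₃) ^ 2)
    - (f₂ * g₀ - f₀ * g₂) * ((f₂ * g₀ - f₀ * g₂) * (f₃ * g₂ - f₂ * g₃)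
      - (f₃ * g₁ - f₁ * g₃) * (f₃ * g₀ - f₀ * g₃))
    + (f₃ * g₀ - f₀ * g₃) * ((f₂ * g₀ - f₀ * g₂) * (f₃ * g₁ - f₁ * g₃)
      - (f₃ * g₀ - f₀ * g₃ + (f₂ * g₁ - f₁ * g₂)) * (f₃ * g₀ - f₀ * g₃))

theorem cubicRes_eq_prod (f₃ a b c g₀ g₁ g₂ g₃ : R) :
    cubicRes (-(f₃ * (a * b * c))) (f₃ * (a * b + a * c + b * c)) (-(f₃ * (a + b + c))) f₃
      g₀ g₁ g₂ g₃ =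
    -(f₃ ^ 3 * ((g₀ + g₁ * a + g₂ * a ^ 2 + g₃ * a ^ 3) * (g₀ + g₁ * b + g₂ * b ^ 2 + g₃ * b ^ 3)
      * (g₀ + g₁ * c + g₂ * c ^ 2 + g₃ * c ^ 3))) := by
  unfold cubicRes
  ring

/-- The coefficient of `w^0` in the general form with coefficients `κ`, at `(a, b, w)`. -/
def gf₀ (a b : R) : R := (a + b) ^ 3

/-- The coefficient of `w^1` in the general form with coefficients `κ`, at `(a, b, w)`. -/
def gf₁ (κ : Fin 10 → R) (a b : R) : R :=
  3 * (a + b) ^ 2 + a * b * (κ 0 + κ 1 * (a + b) + κ 2 * (a * b) + κ 3 * (a + b) ^ 2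
    + κ 5 * (a + b) * (a * b) + κ 6 * (a * b) ^ 2)

/-- The coefficient of `w^2` in the general form with coefficients `κ`, at `(a, b, w)`. -/
def gf₂ (κ : Fin 10 → R) (a b : R) : R :=
  3 * (a + b) + a * b * (κ 1 + κ 2 * (a + b) + 2 * κ 3 * (a + b) + κ 4 * (a * b)
    + κ 5 * ((a + b) ^ 2 + a * b) + 2 * κ 6 * (a * b) * (a + b) + κ 7 * (a * b) * (a + b)
    + κ 8 * (a * b) ^ 2)

/-- The coefficient of `w^3` in the general form with coefficients `κ`, at `(a, b, w)`. -/
def gf₃ (κ : Fin 10 → R) (a b : R) : R :=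
  1 + a * b * (κ 3 + κ 5 * (a + b) + κ 6 * (a + b) ^ 2 + κ 7 * (a * b)
    + κ 8 * (a * b) * (a + b) + κ 9 * (a * b) ^ 2)

/-- The polynomial whose zeros are the quadruples with `0 ∈ (x * y) * z * t`. -/
def quad (κ : Fin 10 → R) (x y z t : R) : R :=
  cubicRes (gf₀ x y) (gf₁ κ x y) (gf₂ κ x y) (gf₃ κ x y)
    (gf₀ z t) (-gf₁ κ z t) (gf₂ κ z t) (-gf₃ κ z t)

/-- The polynomial that vanishes when a product `w * z` with `w ∈ x * y` is not defined. -/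
def lead (κ : Fin 10 → R) (x y z : R) : R :=
  cubicRes (gf₀ x y) (gf₁ κ x y) (gf₂ κ x y) (gf₃ κ x y)
    1 (-(z * (κ 3 + κ 5 * z + κ 6 * z ^ 2)))
    (z * (κ 5 + 2 * κ 6 * z + κ 7 * z + κ 8 * z ^ 2)) (-(z * (κ 6 + κ 8 * z + κ 9 * z ^ 2)))

/-- The coefficients `κ`, multiplied by powers of `s` according to their weights. -/
def weighted (κ : Fin 10 → R) (s : R) : Fin 10 → R :=
  ![κ 0, κ 1 * s, κ 2 * s ^ 2, κ 3 * s ^ 2, κ 4 * s ^ 3, κ 5 * s ^ 3, κ 6 * s ^ 4, κ 7 * s ^ 4,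
    κ 8 * s ^ 5, κ 9 * s ^ 6]

theorem map_quad (φ : R →+* S) (κ : Fin 10 → R) (x y z t : R) :
    φ (quad κ x y z t) = quad (φ ∘ κ) (φ x) (φ y) (φ z) (φ t) := by
  have h2 : φ 2 = 2 := map_ofNat φ 2
  have h3 : φ 3 = 3 := map_ofNat φ 3
  simp [quad, cubicRes, gf₀, gf₁, gf₂, gf₃, h2, h3]

theorem map_weighted (φ : R →+* S) (κ : Fin 10 → R) (s : R) :
    φ ∘ weighted κ s = weighted (φ ∘ κ) (φ s) := by
  ext i
  fin_cases i <;> simp [weighted]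

theorem quad_mul (κ : Fin 10 → R) (s x y z t : R) :
    quad κ (s * x) (s * y) (s * z) (s * t) = s ^ 9 * quad (weighted κ s) x y z t := by
  have h0 : ∀ a b, gf₀ (s * a) (s * b) = s ^ 3 * gf₀ a b := fun a b => by
    unfold gf₀; ring
  have h1 : ∀ a b, gf₁ κ (s * a) (s * b) = s ^ 2 * gf₁ (weighted κ s) a b := fun a b => by
    simp only [gf₁, weighted, Matrix.cons_val]; ring
  have h2 : ∀ a b, gf₂ κ (s * a) (s * b) = s * gf₂ (weighted κ s) a b := fun a b => by
    simp only [gf₂, weighted, Matrix.cons_val]; ring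
  have h3 : ∀ a b, gf₃ κ (s * a) (s * b) = gf₃ (weighted κ s) a b := fun a b => by
    simp only [gf₃, weighted, Matrix.cons_val]; ring
  simp only [quad, h0, h1, h2, h3]
  generalize gf₀ x y = f₀, gf₁ (weighted κ s) x y = f₁, gf₂ (weighted κ s) x y = f₂,
    gf₃ (weighted κ s) x y = f₃, gf₀ z t = g₀, gf₁ (weighted κ s) z t = g₁,
    gf₂ (weighted κ s) z t = g₂, gf₃ (weighted κ s) z t = g₃
  unfold cubicRes
  ring

end Resultant

/-- The general form with coefficients `κ`. -/
def form (κ : Fin 10 → ℂ) : MvPolynomial (Fin 3) ℂ :=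
  generalForm (κ 0) (κ 1) (κ 2) (κ 4) (κ 6) (κ 8) (κ 9) (κ 3) (κ 5) (κ 7)

theorem eval_form (κ : Fin 10 → ℂ) (x y z : ℂ) : eval ![x, y, z] (form κ) =
    gf₀ x y + gf₁ κ x y * z + gf₂ κ x y * z ^ 2 + gf₃ κ x y * z ^ 3 := by
  rw [form, eval_generalForm, gf₀, gf₁, gf₂, gf₃]
  ring

section Law

variable {P : MvPolynomial (Fin 3) ℂ} {κ : Fin 10 → ℂ}

theorem slice_eq (hP : twist 3 P = form κ) (x y : ℂ) :
    slice P x y = Polynomial.C (gf₀ (-x) (-y)) + Polynomial.C (gf₁ κ (-x) (-y)) * Polynomial.X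
      + Polynomial.C (gf₂ κ (-x) (-y)) * Polynomial.X ^ 2
      + Polynomial.C (gf₃ κ (-x) (-y)) * Polynomial.X ^ 3 := by
  refine Polynomial.funext fun z => ?_
  rw [eval_slice_three, hP, eval_form]
  simp

theorem F_zero_eq (hP : twist 3 P = form κ) (x y : ℂ) : F 3 P 0 x y = gf₃ κ (-x) (-y) := by
  rw [F, slice_eq hP]
  simp [Polynomial.coeff_X_pow]

theorem natDegree_slice (hP : twist 3 P = form κ) (x y : ℂ) : (slice P x y).natDegree ≤ 3 := by
  rw [slice_eq hP]
  compute_degree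

theorem slice_eq_prod (hP : twist 3 P = form κ) {x y : ℂ} (h : F 3 P 0 x y ≠ 0) :
    (rootMul P x y).card = 3 ∧ slice P x y = Polynomial.C (F 3 P 0 x y) *
      ((rootMul P x y).map fun w => Polynomial.X - Polynomial.C w).prod := by
  have hd : (slice P x y).natDegree = 3 :=
    le_antisymm (natDegree_slice hP x y) (Polynomial.le_natDegree_of_ne_zero h)
  have hl : (slice P x y).leadingCoeff = F 3 P 0 x y := by
    rw [Polynomial.leadingCoeff, hd, F]
  have hs := IsAlgClosed.splits (slice P x y)
  refine ⟨?_, ?_⟩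
  · rw [rootMul, ← hd]
    exact hs.natDegree_eq_card_roots.symm
  · rw [← hl]
    exact hs.eq_prod_roots

theorem eval_slice_eq_prod (hP : twist 3 P = form κ) {x y : ℂ} (h : F 3 P 0 x y ≠ 0) (t : ℂ) :
    (slice P x y).eval t = F 3 P 0 x y * ((rootMul P x y).map fun w => t - w).prod := by
  rw [(slice_eq_prod hP h).2, Polynomial.eval_mul, Polynomial.eval_C,
    Polynomial.eval_multiset_prod, Multiset.map_map]
  simp

theorem cubicRes_slice (hP : twist 3 P = form κ) {x y : ℂ} (h : F 3 P 0 x y ≠ 0)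
    (g₀ g₁ g₂ g₃ : ℂ) :
    cubicRes (gf₀ (-x) (-y)) (gf₁ κ (-x) (-y)) (gf₂ κ (-x) (-y)) (gf₃ κ (-x) (-y)) g₀ g₁ g₂ g₃ =
      -(F 3 P 0 x y ^ 3 * ((rootMul P x y).map fun w =>
        g₀ + g₁ * w + g₂ * w ^ 2 + g₃ * w ^ 3).prod) := by
  obtain ⟨hc, hs⟩ := slice_eq_prod hP h
  obtain ⟨a, b, c, hr⟩ := Multiset.card_eq_three.1 hc
  rw [hr] at hs ⊢
  generalize F 3 P 0 x y = f₃ at hs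
  have hs' : slice P x y = Polynomial.C (-(f₃ * (a * b * c)))
      + Polynomial.C (f₃ * (a * b + a * c + b * c)) * Polynomial.X
      + Polynomial.C (-(f₃ * (a + b + c))) * Polynomial.X ^ 2
      + Polynomial.C f₃ * Polynomial.X ^ 3 := by
    rw [hs]
    simp
    ring
  rw [slice_eq hP] at hs'
  have hc : ∀ i, _ := fun i => congrArg (Polynomial.coeff · i) hs'
  have c0 := hc 0
  have c1 := hc 1
  have c2 := hc 2
  have c3 := hc 3
  simp only [Polynomial.coeff_add, Polynomial.coeff_C_mul, Polynomial.coeff_X_pow,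
    Polynomial.coeff_X, Polynomial.coeff_C] at c0 c1 c2 c3
  norm_num at c0 c1 c2 c3
  rw [c0, c1, c2, c3]
  have := cubicRes_eq_prod f₃ a b c g₀ g₁ g₂ g₃
  simpa [mul_assoc] using this

theorem lead_eq (hP : twist 3 P = form κ) {x y : ℂ} (h : F 3 P 0 x y ≠ 0) (z : ℂ) :
    lead κ (-x) (-y) (-z) =
      -(F 3 P 0 x y ^ 3 * ((rootMul P x y).map fun w => F 3 P 0 w z).prod) := by
  rw [lead, cubicRes_slice hP h]
  congr 4
  ext w
  rw [F_zero_eq hP, gf₃]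
  ring

theorem quad_eq (hP : twist 3 P = form κ) {x y : ℂ} (h : F 3 P 0 x y ≠ 0) (z t : ℂ) :
    quad κ (-x) (-y) (-z) t =
      -(F 3 P 0 x y ^ 3 * ((rootMul P x y).map fun w => (slice P w z).eval t).prod) := by
  rw [quad, cubicRes_slice hP h]
  congr 4
  ext w
  rw [slice_eq hP]
  simp only [Polynomial.eval_add, Polynomial.eval_mul, Polynomial.eval_C, Polynomial.eval_X,
    Polynomial.eval_pow, gf₀, gf₁, gf₂, gf₃]
  ring

theorem quad_eq_lead_mul (hP : twist 3 P = form κ) {x y z : ℂ} (h : F 3 P 0 x y ≠ 0)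
    (h' : ∀ w ∈ rootMul P x y, F 3 P 0 w z ≠ 0) (t : ℂ) :
    quad κ (-x) (-y) (-z) t = lead κ (-x) (-y) (-z) *
      (((rootMul P x y).bind fun w => rootMul P w z).map fun w => t - w).prod := by
  rw [quad_eq hP h, lead_eq hP h, Multiset.map_bind, Multiset.prod_bind, neg_mul, mul_assoc,
    ← Multiset.prod_map_mul]
  congr 3
  exact Multiset.map_congr rfl fun w hw => eval_slice_eq_prod hP (h' w hw) t

theorem gf₀_comm {R : Type*} [CommRing R] (a b : R) : gf₀ a b = gf₀ b a := by
  unfold gf₀; ring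

theorem gf₁_comm {R : Type*} [CommRing R] (κ : Fin 10 → R) (a b : R) :
    gf₁ κ a b = gf₁ κ b a := by
  unfold gf₁; ring

theorem gf₂_comm {R : Type*} [CommRing R] (κ : Fin 10 → R) (a b : R) :
    gf₂ κ a b = gf₂ κ b a := by
  unfold gf₂; ring

theorem gf₃_comm {R : Type*} [CommRing R] (κ : Fin 10 → R) (a b : R) :
    gf₃ κ a b = gf₃ κ b a := by
  unfold gf₃; ring

theorem slice_comm (hP : twist 3 P = form κ) (x y : ℂ) : slice P x y = slice P y x := by
  rw [slice_eq hP, slice_eq hP, gf₀_comm, gf₁_comm, gf₂_comm, gf₃_comm]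

theorem F_comm (hP : twist 3 P = form κ) (x y : ℂ) : F 3 P 0 x y = F 3 P 0 y x := by
  rw [F, F, slice_comm hP]

theorem rootMul_comm (hP : twist 3 P = form κ) (x y : ℂ) : rootMul P x y = rootMul P y x := by
  rw [rootMul, rootMul, slice_comm hP]

theorem quad_zero {R : Type*} [CommRing R] (κ : Fin 10 → R) (x y z : R) :
    quad κ x y z 0 =
      -(gf₀ x y + gf₁ κ x y * z + gf₂ κ x y * z ^ 2 + gf₃ κ x y * z ^ 3) ^ 3 := by
  have h1 : gf₁ κ z 0 = 3 * z ^ 2 := by unfold gf₁; ring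
  have h2 : gf₂ κ z 0 = 3 * z := by unfold gf₂; ring
  have h3 : gf₃ κ z 0 = 1 := by unfold gf₃; ring
  have h0 : gf₀ z 0 = z ^ 3 := by unfold gf₀; ring
  rw [quad, h0, h1, h2, h3]
  unfold cubicRes
  ring

/-- The value of the general form is a symmetric function of its three arguments. -/
theorem form_symm {R : Type*} [CommRing R] (κ : Fin 10 → R) (x y z : R) :
    gf₀ x y + gf₁ κ x y * z + gf₂ κ x y * z ^ 2 + gf₃ κ x y * z ^ 3 =
      gf₀ z y + gf₁ κ z y * x + gf₂ κ z y * x ^ 2 + gf₃ κ z y * x ^ 3 := by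
  unfold gf₀ gf₁ gf₂ gf₃
  ring

theorem quad_swap_of_defined (hP : twist 3 P = form κ) (hG : IsAlgebraicGroup 3 P) {x y z : ℂ}
    (hxy : gf₃ κ x y ≠ 0) (hzy : gf₃ κ z y ≠ 0) (hl : lead κ x y z ≠ 0) (hl' : lead κ z y x ≠ 0)
    (h0 : gf₀ x y + gf₁ κ x y * z + gf₂ κ x y * z ^ 2 + gf₃ κ x y * z ^ 3 ≠ 0) (t : ℂ) :
    quad κ x y z t = quad κ z y x t := by
  obtain ⟨x, rfl⟩ := neg_surjective x
  obtain ⟨y, rfl⟩ := neg_surjective y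
  obtain ⟨z, rfl⟩ := neg_surjective z
  have hF : F 3 P 0 x y ≠ 0 := by rwa [F_zero_eq hP]
  have hF' : F 3 P 0 z y ≠ 0 := by rwa [F_zero_eq hP]
  have aux : ∀ {x y z : ℂ}, F 3 P 0 x y ≠ 0 → lead κ (-x) (-y) (-z) ≠ 0 →
      ∀ w ∈ rootMul P x y, F 3 P 0 w z ≠ 0 := fun {x y z} h hl w hw hc => by
    rw [lead_eq hP h] at hl
    refine hl ?_
    rw [Multiset.prod_eq_zero (Multiset.mem_map.2 ⟨w, hw, hc⟩), mul_zero, neg_zero]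
  have e := quad_eq_lead_mul hP hF (aux hF hl)
  have e' := quad_eq_lead_mul hP hF' (aux hF' hl')
  have ha := hG.assoc x y z hF (by rwa [F_comm hP]) (aux hF hl) fun w hw => by
    rw [F_comm hP]
    exact aux hF' hl' w (by rwa [rootMul_comm hP])
  have hb : (rootMul P y z).bind (fun w => rootMul P x w) =
      (rootMul P z y).bind fun w => rootMul P w x := by
    rw [rootMul_comm hP y z]
    exact Multiset.bind_congr fun w _ => rootMul_comm hP x w
  rw [ha, hb] at e
  have e0 := e 0
  have e0' := e' 0
  rw [quad_zero] at e0 e0'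
  rw [← form_symm] at e0'
  rw [e t, e' t]
  congr 1
  rw [e0] at e0'
  refine mul_right_cancel₀ ?_ e0'
  intro hc
  rw [hc, mul_zero] at e0
  exact pow_ne_zero 3 h0 (neg_eq_zero.1 e0)

/-- Associativity, as an identity of polynomials in the scaling parameter `s`. -/
theorem quad_swap (hP : twist 3 P = form κ) (hG : IsAlgebraicGroup 3 P) (x y z t : ℂ)
    (h0 : (x + y + z) ^ 3 + κ 0 * (x * y * z) ≠ 0) :
    quad (weighted (Polynomial.C ∘ κ) Polynomial.X) (Polynomial.C x) (Polynomial.C y)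
        (Polynomial.C z) (Polynomial.C t) =
      quad (weighted (Polynomial.C ∘ κ) Polynomial.X) (Polynomial.C z) (Polynomial.C y)
        (Polynomial.C x) (Polynomial.C t) := by
  have hev : ∀ s : ℂ, ∀ x y z t : ℂ,
      (quad (weighted (Polynomial.C ∘ κ) Polynomial.X) (Polynomial.C x) (Polynomial.C y)
        (Polynomial.C z) (Polynomial.C t)).eval s = quad (weighted κ s) x y z t :=
    fun s x y z t => by
      rw [← Polynomial.coe_evalRingHom, map_quad, map_weighted]
      simp only [Polynomial.coe_evalRingHom, Polynomial.eval_C, Polynomial.eval_X]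
      congr 2
      ext i
      simp
  have key : ∀ᶠ s in nhdsWithin (0 : ℂ) {0}ᶜ,
      quad (weighted κ s) x y z t = quad (weighted κ s) z y x t := by
    have near : ∀ f : ℂ → ℂ, Continuous f → f 0 ≠ 0 → ∀ᶠ s in nhdsWithin (0 : ℂ) {0}ᶜ, f s ≠ 0 :=
      fun f hf h => (hf.continuousAt.eventually_ne h).filter_mono nhdsWithin_le_nhds
    filter_upwards [near (fun s => gf₃ κ (s * x) (s * y)) (by unfold gf₃; fun_prop) (by simp [gf₃]),
      near (fun s => gf₃ κ (s * z) (s * y)) (by unfold gf₃; fun_prop) (by simp [gf₃]),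
      near (fun s => lead κ (s * x) (s * y) (s * z))
        (by unfold lead cubicRes gf₀ gf₁ gf₂ gf₃; fun_prop)
        (by simp [lead, cubicRes, gf₀, gf₁, gf₂, gf₃]),
      near (fun s => lead κ (s * z) (s * y) (s * x))
        (by unfold lead cubicRes gf₀ gf₁ gf₂ gf₃; fun_prop)
        (by simp [lead, cubicRes, gf₀, gf₁, gf₂, gf₃]),
      near (fun s => gf₀ x y + gf₁ (weighted κ s) x y * z + gf₂ (weighted κ s) x y * z ^ 2
          + gf₃ (weighted κ s) x y * z ^ 3)
        (by simp only [gf₀, gf₁, gf₂, gf₃, weighted, Matrix.cons_val]; fun_prop)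
        (by
          convert h0 using 1
          simp only [gf₀, gf₁, gf₂, gf₃, weighted, Matrix.cons_val]
          ring), self_mem_nhdsWithin] with s h1 h2 h3 h4 h5 hs
    have hs : s ≠ 0 := hs
    refine mul_left_cancel₀ (pow_ne_zero 9 hs) ?_
    rw [← quad_mul, ← quad_mul]
    refine quad_swap_of_defined hP hG h1 h2 h3 h4 ?_ _
    convert mul_ne_zero (pow_ne_zero 3 hs) h5 using 1
    simp only [gf₀, gf₁, gf₂, gf₃, weighted, Matrix.cons_val]
    ring
  rw [← sub_eq_zero]
  refine Polynomial.eq_zero_of_infinite_isRoot _ ?_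
  have hi : {s : ℂ | quad (weighted κ s) x y z t = quad (weighted κ s) z y x t} ∈
      nhdsWithin (0 : ℂ) {0}ᶜ := key
  have hi' := infinite_of_mem_nhds 0 (insert_mem_nhds_iff.2 hi)
  rw [Set.Infinite, Set.finite_insert] at hi'
  refine Set.Infinite.mono (fun s hs => ?_) hi'
  rw [Set.mem_ofPred_eq, Polynomial.IsRoot.def, Polynomial.eval_sub, hev, hev, sub_eq_zero]
  exact hs

/-- Associativity, as an identity in a quotient of the ring of polynomials in the scaling
parameter. -/
theorem quad_swap_mod (hP : twist 3 P = form κ) (hG : IsAlgebraicGroup 3 P) (x y z t : ℤ) (N : ℕ)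
    (h0 : (x + y + z : ℂ) ^ 3 + κ 0 * (x * y * z) ≠ 0) :
    quad (weighted (AdjoinRoot.of (Polynomial.X ^ N : Polynomial ℂ) ∘ κ) (AdjoinRoot.root _))
        x y z t =
      quad (weighted (AdjoinRoot.of (Polynomial.X ^ N : Polynomial ℂ) ∘ κ) (AdjoinRoot.root _))
        z y x t := by
  have h := congrArg (AdjoinRoot.mk (Polynomial.X ^ N : Polynomial ℂ))
    (quad_swap hP hG x y z t h0)
  rw [map_quad, map_quad, map_weighted, AdjoinRoot.mk_X] at h
  simp only [map_intCast] at h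
  exact h

end Law

/-! ### Expansion of the associativity condition in the scaling parameter -/

section Expansion

set_option linter.unusedSimpArgs false
set_option maxRecDepth 4000

variable {R : Type*} [CommRing R]

theorem quad_order_zero (k₀ k₂ k₄ l₄ k₆ l₆ k₈ l₈ k₁₀ k₁₂ e : R) (he : e ^ 1 = 0) :
    quad (weighted ![k₀, k₂, k₄, l₄, k₆, l₆, k₈, l₈, k₁₀, k₁₂] e) 1 (-1) 2 1 -
      quad (weighted ![k₀, k₂, k₄, l₄, k₆, l₆, k₈, l₈, k₁₀, k₁₂] e) 2 (-1) 1 1 =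
        108 * (k₀ ^ 2 * (k₀ + 27)) := by
  rw [pow_one] at he
  subst he
  simp [quad, gf₀, gf₁, gf₂, gf₃, weighted, cubicRes]
  ring

theorem quad_order_zero' (k₀ k₂ k₄ l₄ k₆ l₆ k₈ l₈ k₁₀ k₁₂ e : R) (he : e ^ 1 = 0) :
    quad (weighted ![k₀, k₂, k₄, l₄, k₆, l₆, k₈, l₈, k₁₀, k₁₂] e) 1 1 2 (-2) -
      quad (weighted ![k₀, k₂, k₄, l₄, k₆, l₆, k₈, l₈, k₁₀, k₁₂] e) 2 1 1 (-2) =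
        -96 * (k₀ ^ 2 * (k₀ + 27)) := by
  rw [pow_one] at he
  subst he
  simp [quad, gf₀, gf₁, gf₂, gf₃, weighted, cubicRes]
  ring

theorem quad_elliptic_order_one (k₂ k₄ l₄ k₆ l₆ k₈ l₈ k₁₀ k₁₂ e : R) (he : e ^ 2 = 0) :
    quad (weighted ![-27, k₂, k₄, l₄, k₆, l₆, k₈, l₈, k₁₀, k₁₂] e) 1 (-1) 2 1 -
      quad (weighted ![-27, k₂, k₄, l₄, k₆, l₆, k₈, l₈, k₁₀, k₁₂] e) 2 (-1) 1 1 =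
        -393660 * (k₂ * e) := by
  have z : ∀ n, 2 ≤ n → e ^ n = 0 := fun n hn => pow_eq_zero_of_le hn he
  simp (disch := omega) only [weighted, Matrix.cons_val, z, mul_zero, zero_mul]
  simp only [quad, gf₀, gf₁, gf₂, gf₃, Matrix.cons_val, cubicRes, mul_zero, add_zero, zero_add]
  ring_nf
  simp (disch := omega) only [z, mul_zero, zero_mul, add_zero, zero_add, sub_zero, zero_sub,
    neg_zero]

theorem quad_elliptic_order_two (k₄ l₄ k₆ l₆ k₈ l₈ k₁₀ k₁₂ e : R) (he : e ^ 3 = 0) :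
    quad (weighted ![-27, 0, k₄, l₄, k₆, l₆, k₈, l₈, k₁₀, k₁₂] e) 1 (-1) 2 1 -
      quad (weighted ![-27, 0, k₄, l₄, k₆, l₆, k₈, l₈, k₁₀, k₁₂] e) 2 (-1) 1 1 =
        -708588 * ((k₄ + 3 * l₄) * e ^ 2) := by
  have z : ∀ n, 3 ≤ n → e ^ n = 0 := fun n hn => pow_eq_zero_of_le hn he
  simp (disch := omega) only [weighted, Matrix.cons_val, z, mul_zero, zero_mul]
  simp only [quad, gf₀, gf₁, gf₂, gf₃, Matrix.cons_val, cubicRes, mul_zero, add_zero, zero_add]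
  ring_nf
  simp (disch := omega) only [z, mul_zero, zero_mul, add_zero, zero_add, sub_zero, zero_sub,
    neg_zero]

theorem quad_elliptic_order_three (k₆ l₆ k₈ l₈ k₁₀ k₁₂ c e : R) (he : e ^ 4 = 0) :
    quad (weighted ![-27, 0, -54 * c, 18 * c, k₆, l₆, k₈, l₈, k₁₀, k₁₂] e) 1 (-1) 2 1 -
      quad (weighted ![-27, 0, -54 * c, 18 * c, k₆, l₆, k₈, l₈, k₁₀, k₁₂] e) 2 (-1) 1 1 =
        (-586116 * k₆ - 11573604 * l₆) * e ^ 3 := by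
  have z : ∀ n, 4 ≤ n → e ^ n = 0 := fun n hn => pow_eq_zero_of_le hn he
  simp (disch := omega) only [weighted, Matrix.cons_val, z, mul_zero, zero_mul]
  simp only [quad, gf₀, gf₁, gf₂, gf₃, Matrix.cons_val, cubicRes, mul_zero, add_zero, zero_add]
  ring_nf
  simp (disch := omega) only [z, mul_zero, zero_mul, add_zero, zero_add, sub_zero, zero_sub,
    neg_zero]

theorem quad_elliptic_order_three' (k₆ l₆ k₈ l₈ k₁₀ k₁₂ c e : R) (he : e ^ 4 = 0) :
    quad (weighted ![-27, 0, -54 * c, 18 * c, k₆, l₆, k₈, l₈, k₁₀, k₁₂] e) 1 1 2 (-2) -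
      quad (weighted ![-27, 0, -54 * c, 18 * c, k₆, l₆, k₈, l₈, k₁₀, k₁₂] e) 2 1 1 (-2) =
        (-854784 * k₆ + 71414784 * l₆) * e ^ 3 := by
  have z : ∀ n, 4 ≤ n → e ^ n = 0 := fun n hn => pow_eq_zero_of_le hn he
  simp (disch := omega) only [weighted, Matrix.cons_val, z, mul_zero, zero_mul]
  simp only [quad, gf₀, gf₁, gf₂, gf₃, Matrix.cons_val, cubicRes, mul_zero, add_zero, zero_add]
  ring_nf
  simp (disch := omega) only [z, mul_zero, zero_mul, add_zero, zero_add, sub_zero, zero_sub,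
    neg_zero]

theorem quad_elliptic_order_four (k₈ l₈ k₁₀ k₁₂ c e : R) (he : e ^ 5 = 0) :
    quad (weighted ![-27, 0, -54 * c, 18 * c, 0, 0, k₈, l₈, k₁₀, k₁₂] e) 1 (-1) 2 1 -
      quad (weighted ![-27, 0, -54 * c, 18 * c, 0, 0, k₈, l₈, k₁₀, k₁₂] e) 2 (-1) 1 1 =
        (-532858176 * c ^ 2 - 31624020 * k₈ - 3962844 * l₈) * e ^ 4 := by
  have z : ∀ n, 5 ≤ n → e ^ n = 0 := fun n hn => pow_eq_zero_of_le hn he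
  simp (disch := omega) only [weighted, Matrix.cons_val, z, mul_zero, zero_mul]
  simp only [quad, gf₀, gf₁, gf₂, gf₃, Matrix.cons_val, cubicRes, mul_zero, add_zero, zero_add]
  ring_nf
  simp (disch := omega) only [z, mul_zero, zero_mul, add_zero, zero_add, sub_zero, zero_sub,
    neg_zero]

theorem quad_elliptic_order_four' (k₈ l₈ k₁₀ k₁₂ c e : R) (he : e ^ 5 = 0) :
    quad (weighted ![-27, 0, -54 * c, 18 * c, 0, 0, k₈, l₈, k₁₀, k₁₂] e) 1 1 2 (-2) -
      quad (weighted ![-27, 0, -54 * c, 18 * c, 0, 0, k₈, l₈, k₁₀, k₁₂] e) 2 1 1 (-2) =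
        (4339630080 * c ^ 2 + 147760128 * k₈ - 4322304 * l₈) * e ^ 4 := by
  have z : ∀ n, 5 ≤ n → e ^ n = 0 := fun n hn => pow_eq_zero_of_le hn he
  simp (disch := omega) only [weighted, Matrix.cons_val, z, mul_zero, zero_mul]
  simp only [quad, gf₀, gf₁, gf₂, gf₃, Matrix.cons_val, cubicRes, mul_zero, add_zero, zero_add]
  ring_nf
  simp (disch := omega) only [z, mul_zero, zero_mul, add_zero, zero_add, sub_zero, zero_sub,
    neg_zero]

theorem quad_elliptic_order_five (k₁₀ k₁₂ c e : R) (he : e ^ 6 = 0) :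
    quad (weighted ![-27, 0, -54 * c, 18 * c, 0, 0, -27 * c ^ 2, 81 * c ^ 2, k₁₀, k₁₂] e) 1 (-1) 2
      1 -
      quad (weighted ![-27, 0, -54 * c, 18 * c, 0, 0, -27 * c ^ 2, 81 * c ^ 2, k₁₀, k₁₂] e) 2 (-1) 1 1 =
        -13830588 * (k₁₀ * e ^ 5) := by
  have z : ∀ n, 6 ≤ n → e ^ n = 0 := fun n hn => pow_eq_zero_of_le hn he
  simp (disch := omega) only [weighted, Matrix.cons_val, z, mul_zero, zero_mul]
  simp only [quad, gf₀, gf₁, gf₂, gf₃, Matrix.cons_val, cubicRes, mul_zero, add_zero, zero_add]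
  ring_nf
  simp (disch := omega) only [z, mul_zero, zero_mul, add_zero, zero_add, sub_zero, zero_sub,
    neg_zero]

theorem quad_elliptic_order_six (k₁₂ c e : R) (he : e ^ 7 = 0) :
    quad (weighted ![-27, 0, -54 * c, 18 * c, 0, 0, -27 * c ^ 2, 81 * c ^ 2, 0, k₁₂] e) 1 (-1) 2 1 -
      quad (weighted ![-27, 0, -54 * c, 18 * c, 0, 0, -27 * c ^ 2, 81 * c ^ 2, 0, k₁₂] e) 2 (-1) 1 1 =
        -22911012 * (k₁₂ * e ^ 6) := by
  have z : ∀ n, 7 ≤ n → e ^ n = 0 := fun n hn => pow_eq_zero_of_le hn he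
  simp (disch := omega) only [weighted, Matrix.cons_val, z, mul_zero, zero_mul]
  simp only [quad, gf₀, gf₁, gf₂, gf₃, Matrix.cons_val, cubicRes, mul_zero, add_zero, zero_add]
  ring_nf
  simp (disch := omega) only [z, mul_zero, zero_mul, add_zero, zero_add, sub_zero, zero_sub,
    neg_zero]

theorem quad_diagonal_order_two (k₂ k₄ l₄ k₆ l₆ k₈ l₈ k₁₀ k₁₂ e : R) (he : e ^ 3 = 0) :
    quad (weighted ![0, k₂, k₄, l₄, k₆, l₆, k₈, l₈, k₁₀, k₁₂] e) 1 (-1) 2 1 -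
      quad (weighted ![0, k₂, k₄, l₄, k₆, l₆, k₈, l₈, k₁₀, k₁₂] e) 2 (-1) 1 1 =
        2916 * (k₂ ^ 2 * e ^ 2) := by
  have z : ∀ n, 3 ≤ n → e ^ n = 0 := fun n hn => pow_eq_zero_of_le hn he
  simp (disch := omega) only [weighted, Matrix.cons_val, z, mul_zero, zero_mul]
  simp only [quad, gf₀, gf₁, gf₂, gf₃, Matrix.cons_val, cubicRes, mul_zero, add_zero, zero_add]
  ring_nf
  simp (disch := omega) only [z, mul_zero, zero_mul, add_zero, zero_add, sub_zero, zero_sub,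
    neg_zero]

theorem quad_diagonal_order_three (k₄ l₄ k₆ l₆ k₈ l₈ k₁₀ k₁₂ e : R) (he : e ^ 4 = 0) :
    quad (weighted ![0, 0, k₄, l₄, k₆, l₆, k₈, l₈, k₁₀, k₁₂] e) 1 (-1) 2 1 -
      quad (weighted ![0, 0, k₄, l₄, k₆, l₆, k₈, l₈, k₁₀, k₁₂] e) 2 (-1) 1 1 =
        17496 * (k₆ * e ^ 3) := by
  have z : ∀ n, 4 ≤ n → e ^ n = 0 := fun n hn => pow_eq_zero_of_le hn he
  simp (disch := omega) only [weighted, Matrix.cons_val, z, mul_zero, zero_mul]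
  simp only [quad, gf₀, gf₁, gf₂, gf₃, Matrix.cons_val, cubicRes, mul_zero, add_zero, zero_add]
  ring_nf
  simp (disch := omega) only [z, mul_zero, zero_mul, add_zero, zero_add, sub_zero, zero_sub,
    neg_zero]

theorem quad_diagonal_order_four (k₄ l₄ l₆ k₈ l₈ k₁₀ k₁₂ e : R) (he : e ^ 5 = 0) :
    quad (weighted ![0, 0, k₄, l₄, 0, l₆, k₈, l₈, k₁₀, k₁₂] e) 1 (-1) 2 1 -
      quad (weighted ![0, 0, k₄, l₄, 0, l₆, k₈, l₈, k₁₀, k₁₂] e) 2 (-1) 1 1 =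
        (8748 * k₄ ^ 2 - 8748 * k₄ * l₄ - 17496 * l₄ ^ 2 + 26244 * k₈ + 52488 * l₈) * e ^ 4 :=
          by
  have z : ∀ n, 5 ≤ n → e ^ n = 0 := fun n hn => pow_eq_zero_of_le hn he
  simp (disch := omega) only [weighted, Matrix.cons_val, z, mul_zero, zero_mul]
  simp only [quad, gf₀, gf₁, gf₂, gf₃, Matrix.cons_val, cubicRes, mul_zero, add_zero, zero_add]
  ring_nf
  simp (disch := omega) only [z, mul_zero, zero_mul, add_zero, zero_add, sub_zero, zero_sub,
    neg_zero]

theorem quad_diagonal_order_four' (k₄ l₄ l₆ k₈ l₈ k₁₀ k₁₂ e : R) (he : e ^ 5 = 0) :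
    quad (weighted ![0, 0, k₄, l₄, 0, l₆, k₈, l₈, k₁₀, k₁₂] e) 1 1 2 (-2) -
      quad (weighted ![0, 0, k₄, l₄, 0, l₆, k₈, l₈, k₁₀, k₁₂] e) 2 1 1 (-2) =
        (-47520 * k₄ ^ 2 + 1536 * k₄ * l₄ + 3072 * l₄ ^ 2 - 4608 * k₈ - 9216 * l₈) * e ^ 4 :=
          by
  have z : ∀ n, 5 ≤ n → e ^ n = 0 := fun n hn => pow_eq_zero_of_le hn he
  simp (disch := omega) only [weighted, Matrix.cons_val, z, mul_zero, zero_mul]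
  simp only [quad, gf₀, gf₁, gf₂, gf₃, Matrix.cons_val, cubicRes, mul_zero, add_zero, zero_add]
  ring_nf
  simp (disch := omega) only [z, mul_zero, zero_mul, add_zero, zero_add, sub_zero, zero_sub,
    neg_zero]

theorem quad_diagonal_order_five (l₆ k₁₀ k₁₂ a m e : R) (he : e ^ 6 = 0) :
    quad (weighted ![0, 0, 0, 3 * a, 0, l₆, -6 * m, 3 * a ^ 2 + 3 * m, k₁₀, k₁₂] e) 1 (-1) 2 1 -
      quad (weighted ![0, 0, 0, 3 * a, 0, l₆, -6 * m, 3 * a ^ 2 + 3 * m, k₁₀, k₁₂] e) 2 (-1) 1 1 =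
        26244 * ((k₁₀ - a * l₆) * e ^ 5) := by
  have z : ∀ n, 6 ≤ n → e ^ n = 0 := fun n hn => pow_eq_zero_of_le hn he
  simp (disch := omega) only [weighted, Matrix.cons_val, z, mul_zero, zero_mul]
  simp only [quad, gf₀, gf₁, gf₂, gf₃, Matrix.cons_val, cubicRes, mul_zero, add_zero, zero_add]
  ring_nf
  simp (disch := omega) only [z, mul_zero, zero_mul, add_zero, zero_add, sub_zero, zero_sub,
    neg_zero]

theorem quad_diagonal_order_six (l₆ k₁₂ a m e : R) (he : e ^ 7 = 0) :
    quad (weighted ![0, 0, 0, 3 * a, 0, l₆, -6 * m, 3 * a ^ 2 + 3 * m, a * l₆, k₁₂] e) 1 (-1) 2 1 -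
      quad (weighted ![0, 0, 0, 3 * a, 0, l₆, -6 * m, 3 * a ^ 2 + 3 * m, a * l₆, k₁₂] e) 2 (-1) 1 1 =
        (34992 * l₆ ^ 2 + 78732 * (a ^ 3 + a * m - k₁₂)) * e ^ 6 := by
  have z : ∀ n, 7 ≤ n → e ^ n = 0 := fun n hn => pow_eq_zero_of_le hn he
  simp (disch := omega) only [weighted, Matrix.cons_val, z, mul_zero, zero_mul]
  simp only [quad, gf₀, gf₁, gf₂, gf₃, Matrix.cons_val, cubicRes, mul_zero, add_zero, zero_add]
  ring_nf
  simp (disch := omega) only [z, mul_zero, zero_mul, add_zero, zero_add, sub_zero, zero_sub,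
    neg_zero]

theorem quad_diagonal_order_six' (l₆ k₁₂ a m e : R) (he : e ^ 7 = 0) :
    quad (weighted ![0, 0, 0, 3 * a, 0, l₆, -6 * m, 3 * a ^ 2 + 3 * m, a * l₆, k₁₂] e) 1 1 2 (-2) -
      quad (weighted ![0, 0, 0, 3 * a, 0, l₆, -6 * m, 3 * a ^ 2 + 3 * m, a * l₆, k₁₂] e) 2 1 1 (-2) =
        (-30336 * l₆ ^ 2 - 55296 * (a ^ 3 + a * m - k₁₂)) * e ^ 6 := by
  have z : ∀ n, 7 ≤ n → e ^ n = 0 := fun n hn => pow_eq_zero_of_le hn he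
  simp (disch := omega) only [weighted, Matrix.cons_val, z, mul_zero, zero_mul]
  simp only [quad, gf₀, gf₁, gf₂, gf₃, Matrix.cons_val, cubicRes, mul_zero, add_zero, zero_add]
  ring_nf
  simp (disch := omega) only [z, mul_zero, zero_mul, add_zero, zero_add, sub_zero, zero_sub,
    neg_zero]

theorem quad_diagonal_order_eight (a m e : R) (he : e ^ 9 = 0) :
    quad (weighted ![0, 0, 0, 3 * a, 0, 0, -6 * m, 3 * a ^ 2 + 3 * m, 0, a ^ 3 + a * m] e) 1 (-1)
      2 1 -
      quad (weighted ![0, 0, 0, 3 * a, 0, 0, -6 * m, 3 * a ^ 2 + 3 * m, 0, a ^ 3 + a * m] e) 2 (-1) 1 1 =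
        3779136 * (m ^ 2 * e ^ 8) := by
  have z : ∀ n, 9 ≤ n → e ^ n = 0 := fun n hn => pow_eq_zero_of_le hn he
  simp (disch := omega) only [weighted, Matrix.cons_val, z, mul_zero, zero_mul]
  simp only [quad, gf₀, gf₁, gf₂, gf₃, Matrix.cons_val, cubicRes, mul_zero, add_zero, zero_add]
  ring_nf
  simp (disch := omega) only [z, mul_zero, zero_mul, add_zero, zero_add, sub_zero, zero_sub,
    neg_zero]

end Expansion

section Necessity

set_option linter.unusedSimpArgs false

variable {P : MvPolynomial (Fin 3) ℂ}

theorem eq_zero_of_of_mul_root_pow {N j : ℕ} (hj : j < N) {c : ℂ}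
    (h : AdjoinRoot.of (Polynomial.X ^ N : Polynomial ℂ) c * AdjoinRoot.root _ ^ j = 0) :
    c = 0 := by
  rw [← AdjoinRoot.mk_C, ← AdjoinRoot.mk_X, ← map_pow, ← map_mul, AdjoinRoot.mk_eq_zero,
    Polynomial.X_pow_dvd_iff] at h
  simpa using h j hj

theorem root_pow_self (N : ℕ) :
    AdjoinRoot.root (Polynomial.X ^ N : Polynomial ℂ) ^ N = 0 := by
  rw [← AdjoinRoot.mk_X, ← map_pow, AdjoinRoot.mk_self]

theorem quad_swap_vec {a₀ a₁ a₂ a₃ a₄ a₅ a₆ a₇ a₈ a₉ : ℂ}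
    (hP : twist 3 P = form ![a₀, a₁, a₂, a₃, a₄, a₅, a₆, a₇, a₈, a₉])
    (hG : IsAlgebraicGroup 3 P) (N : ℕ) (x y z t : ℤ)
    (h0 : (x + y + z : ℂ) ^ 3 + a₀ * (x * y * z) ≠ 0) :
    let φ := AdjoinRoot.of (Polynomial.X ^ N : Polynomial ℂ)
    let e := AdjoinRoot.root (Polynomial.X ^ N : Polynomial ℂ)
    quad (weighted ![φ a₀, φ a₁, φ a₂, φ a₃, φ a₄, φ a₅, φ a₆, φ a₇, φ a₈, φ a₉] e) x y z t
      - quad (weighted ![φ a₀, φ a₁, φ a₂, φ a₃, φ a₄, φ a₅, φ a₆, φ a₇, φ a₈, φ a₉] e) z y x t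
      = 0 := by
  intro φ e
  have h := quad_swap_mod hP hG x y z t N (by simpa using h0)
  have hv : φ ∘ ![a₀, a₁, a₂, a₃, a₄, a₅, a₆, a₇, a₈, a₉] =
      ![φ a₀, φ a₁, φ a₂, φ a₃, φ a₄, φ a₅, φ a₆, φ a₇, φ a₈, φ a₉] := by
    ext i
    fin_cases i <;> rfl
  rw [hv] at h
  rw [sub_eq_zero]
  exact h

theorem coeff_two_of_elliptic {k₂ k₄ l₄ k₆ l₆ k₈ l₈ k₁₀ k₁₂ : ℂ}
    (hP : twist 3 P = form ![-27, k₂, k₄, l₄, k₆, l₆, k₈, l₈, k₁₀, k₁₂])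
    (hG : IsAlgebraicGroup 3 P) : k₂ = 0 := by
  have h : -393660 * k₂ = 0 := by
    have h := quad_swap_vec hP hG 2 1 (-1) 2 1 (by norm_num)
    simp only [map_neg, map_ofNat, map_zero, map_mul, map_add, map_pow, Int.cast_one, Int.cast_neg,
      Int.cast_ofNat] at h
    rw [quad_elliptic_order_one _ _ _ _ _ _ _ _ _ _ (root_pow_self 2)] at h
    refine eq_zero_of_of_mul_root_pow (N := 2) (j := 1) (by norm_num) ?_
    simp only [map_neg, map_ofNat, map_mul, map_add, map_sub, map_pow]
    linear_combination h
  linear_combination -h / 393660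

theorem coeff_four_of_elliptic {k₄ l₄ k₆ l₆ k₈ l₈ k₁₀ k₁₂ : ℂ}
    (hP : twist 3 P = form ![-27, 0, k₄, l₄, k₆, l₆, k₈, l₈, k₁₀, k₁₂])
    (hG : IsAlgebraicGroup 3 P) : k₄ = -3 * l₄ := by
  have h : -708588 * (k₄ + 3 * l₄) = 0 := by
    have h := quad_swap_vec hP hG 3 1 (-1) 2 1 (by norm_num)
    simp only [map_neg, map_ofNat, map_zero, map_mul, map_add, map_pow, Int.cast_one, Int.cast_neg,
      Int.cast_ofNat] at h
    rw [quad_elliptic_order_two _ _ _ _ _ _ _ _ _ (root_pow_self 3)] at h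
    refine eq_zero_of_of_mul_root_pow (N := 3) (j := 2) (by norm_num) ?_
    simp only [map_neg, map_ofNat, map_mul, map_add, map_sub, map_pow]
    linear_combination h
  linear_combination -h / 708588

theorem coeff_six_of_elliptic {c k₆ l₆ k₈ l₈ k₁₀ k₁₂ : ℂ}
    (hP : twist 3 P = form ![-27, 0, -54 * c, 18 * c, k₆, l₆, k₈, l₈, k₁₀, k₁₂])
    (hG : IsAlgebraicGroup 3 P) : k₆ = 0 ∧ l₆ = 0 := by
  have h : -586116 * k₆ - 11573604 * l₆ = 0 := by
    have h := quad_swap_vec hP hG 4 1 (-1) 2 1 (by norm_num)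
    simp only [map_neg, map_ofNat, map_zero, map_mul, map_add, map_pow, Int.cast_one, Int.cast_neg,
      Int.cast_ofNat] at h
    rw [quad_elliptic_order_three _ _ _ _ _ _ _ _ (root_pow_self 4)] at h
    refine eq_zero_of_of_mul_root_pow (N := 4) (j := 3) (by norm_num) ?_
    simp only [map_neg, map_ofNat, map_mul, map_add, map_sub, map_pow]
    linear_combination h
  have h' : -854784 * k₆ + 71414784 * l₆ = 0 := by
    have h := quad_swap_vec hP hG 4 1 1 2 (-2) (by norm_num)
    simp only [map_neg, map_ofNat, map_zero, map_mul, map_add, map_pow, Int.cast_one, Int.cast_neg,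
      Int.cast_ofNat] at h
    rw [quad_elliptic_order_three' _ _ _ _ _ _ _ _ (root_pow_self 4)] at h
    refine eq_zero_of_of_mul_root_pow (N := 4) (j := 3) (by norm_num) ?_
    simp only [map_neg, map_ofNat, map_mul, map_add, map_sub, map_pow]
    linear_combination h
  exact ⟨by linear_combination (-41 / 29710395 : ℂ) * h + (-7 / 31299840 : ℂ) * h',
    by linear_combination (-53 / 3208722660 : ℂ) * h + (67 / 5915669760 : ℂ) * h'⟩

theorem coeff_eight_of_elliptic {c k₈ l₈ k₁₀ k₁₂ : ℂ}
    (hP : twist 3 P = form ![-27, 0, -54 * c, 18 * c, 0, 0, k₈, l₈, k₁₀, k₁₂])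
    (hG : IsAlgebraicGroup 3 P) : k₈ = -27 * c ^ 2 ∧ l₈ = 81 * c ^ 2 := by
  have h : -532858176 * c ^ 2 - 31624020 * k₈ - 3962844 * l₈ = 0 := by
    have h := quad_swap_vec hP hG 5 1 (-1) 2 1 (by norm_num)
    simp only [map_neg, map_ofNat, map_zero, map_mul, map_add, map_pow, Int.cast_one, Int.cast_neg,
      Int.cast_ofNat] at h
    rw [quad_elliptic_order_four _ _ _ _ _ _ (root_pow_self 5)] at h
    refine eq_zero_of_of_mul_root_pow (N := 5) (j := 4) (by norm_num) ?_
    simp only [map_neg, map_ofNat, map_mul, map_add, map_sub, map_pow]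
    linear_combination h
  have h' : 4339630080 * c ^ 2 + 147760128 * k₈ - 4322304 * l₈ = 0 := by
    have h := quad_swap_vec hP hG 5 1 1 2 (-2) (by norm_num)
    simp only [map_neg, map_ofNat, map_zero, map_mul, map_add, map_pow, Int.cast_one, Int.cast_neg,
      Int.cast_ofNat] at h
    rw [quad_elliptic_order_four' _ _ _ _ _ _ (root_pow_self 5)] at h
    refine eq_zero_of_of_mul_root_pow (N := 5) (j := 4) (by norm_num) ?_
    simp only [map_neg, map_ofNat, map_mul, map_add, map_sub, map_pow]
    linear_combination h
  exact ⟨by linear_combination (-469 / 78367943232 : ℂ) * h + (151 / 27520155648 : ℂ) * h',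
    by linear_combination (-16033 / 78367943232 : ℂ) * h + (-1205 / 27520155648 : ℂ) * h'⟩

theorem coeff_ten_of_elliptic {c k₁₀ k₁₂ : ℂ}
    (hP : twist 3 P = form ![-27, 0, -54 * c, 18 * c, 0, 0, -27 * c ^ 2, 81 * c ^ 2, k₁₀, k₁₂])
    (hG : IsAlgebraicGroup 3 P) : k₁₀ = 0 := by
  have h : -13830588 * k₁₀ = 0 := by
    have h := quad_swap_vec hP hG 6 1 (-1) 2 1 (by norm_num)
    simp only [map_neg, map_ofNat, map_zero, map_mul, map_add, map_pow, Int.cast_one, Int.cast_neg,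
      Int.cast_ofNat] at h
    rw [quad_elliptic_order_five _ _ _ _ (root_pow_self 6)] at h
    refine eq_zero_of_of_mul_root_pow (N := 6) (j := 5) (by norm_num) ?_
    simp only [map_neg, map_ofNat, map_mul, map_add, map_sub, map_pow]
    linear_combination h
  linear_combination -h / 13830588

theorem coeff_twelve_of_elliptic {c k₁₂ : ℂ}
    (hP : twist 3 P = form ![-27, 0, -54 * c, 18 * c, 0, 0, -27 * c ^ 2, 81 * c ^ 2, 0, k₁₂])
    (hG : IsAlgebraicGroup 3 P) : k₁₂ = 0 := by
  have h : -22911012 * k₁₂ = 0 := by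
    have h := quad_swap_vec hP hG 7 1 (-1) 2 1 (by norm_num)
    simp only [map_neg, map_ofNat, map_zero, map_mul, map_add, map_pow, Int.cast_one, Int.cast_neg,
      Int.cast_ofNat] at h
    rw [quad_elliptic_order_six _ _ _ (root_pow_self 7)] at h
    refine eq_zero_of_of_mul_root_pow (N := 7) (j := 6) (by norm_num) ?_
    simp only [map_neg, map_ofNat, map_mul, map_add, map_sub, map_pow]
    linear_combination h
  linear_combination -h / 22911012

theorem coeff_two_of_diagonal {k₂ k₄ l₄ k₆ l₆ k₈ l₈ k₁₀ k₁₂ : ℂ}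
    (hP : twist 3 P = form ![0, k₂, k₄, l₄, k₆, l₆, k₈, l₈, k₁₀, k₁₂])
    (hG : IsAlgebraicGroup 3 P) : k₂ = 0 := by
  have h : 2916 * k₂ ^ 2 = 0 := by
    have h := quad_swap_vec hP hG 3 1 (-1) 2 1 (by norm_num)
    simp only [map_neg, map_ofNat, map_zero, map_mul, map_add, map_pow, Int.cast_one, Int.cast_neg,
      Int.cast_ofNat] at h
    rw [quad_diagonal_order_two _ _ _ _ _ _ _ _ _ _ (root_pow_self 3)] at h
    refine eq_zero_of_of_mul_root_pow (N := 3) (j := 2) (by norm_num) ?_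
    simp only [map_neg, map_ofNat, map_mul, map_add, map_sub, map_pow]
    linear_combination h
  simpa using h

theorem coeff_six_of_diagonal {k₄ l₄ k₆ l₆ k₈ l₈ k₁₀ k₁₂ : ℂ}
    (hP : twist 3 P = form ![0, 0, k₄, l₄, k₆, l₆, k₈, l₈, k₁₀, k₁₂])
    (hG : IsAlgebraicGroup 3 P) : k₆ = 0 := by
  have h : 17496 * k₆ = 0 := by
    have h := quad_swap_vec hP hG 4 1 (-1) 2 1 (by norm_num)
    simp only [map_neg, map_ofNat, map_zero, map_mul, map_add, map_pow, Int.cast_one, Int.cast_neg,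
      Int.cast_ofNat] at h
    rw [quad_diagonal_order_three _ _ _ _ _ _ _ _ _ (root_pow_self 4)] at h
    refine eq_zero_of_of_mul_root_pow (N := 4) (j := 3) (by norm_num) ?_
    simp only [map_neg, map_ofNat, map_mul, map_add, map_sub, map_pow]
    linear_combination h
  simpa using h

theorem coeff_four_of_diagonal {k₄ l₄ l₆ k₈ l₈ k₁₀ k₁₂ : ℂ}
    (hP : twist 3 P = form ![0, 0, k₄, l₄, 0, l₆, k₈, l₈, k₁₀, k₁₂])
    (hG : IsAlgebraicGroup 3 P) : k₄ = 0 ∧ 3 * k₈ = 2 * l₄ ^ 2 - 6 * l₈ := by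
  have h : 8748 * k₄ ^ 2 - 8748 * k₄ * l₄ - 17496 * l₄ ^ 2 + 26244 * k₈ + 52488 * l₈ = 0 := by
    have h := quad_swap_vec hP hG 5 1 (-1) 2 1 (by norm_num)
    simp only [map_neg, map_ofNat, map_zero, map_mul, map_add, map_pow, Int.cast_one, Int.cast_neg,
      Int.cast_ofNat] at h
    rw [quad_diagonal_order_four _ _ _ _ _ _ _ _ (root_pow_self 5)] at h
    refine eq_zero_of_of_mul_root_pow (N := 5) (j := 4) (by norm_num) ?_
    simp only [map_neg, map_ofNat, map_mul, map_add, map_sub, map_pow]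
    linear_combination h
  have h' : -47520 * k₄ ^ 2 + 1536 * k₄ * l₄ + 3072 * l₄ ^ 2 - 4608 * k₈ - 9216 * l₈ = 0 := by
    have h := quad_swap_vec hP hG 5 1 1 2 (-2) (by norm_num)
    simp only [map_neg, map_ofNat, map_zero, map_mul, map_add, map_pow, Int.cast_one, Int.cast_neg,
      Int.cast_ofNat] at h
    rw [quad_diagonal_order_four' _ _ _ _ _ _ _ _ (root_pow_self 5)] at h
    refine eq_zero_of_of_mul_root_pow (N := 5) (j := 4) (by norm_num) ?_
    simp only [map_neg, map_ofNat, map_mul, map_add, map_sub, map_pow]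
    linear_combination h
  have hk : k₄ = 0 := by
    have : k₄ ^ 2 = 0 := by linear_combination (-1 / 45984 : ℂ) * h' - (128 / 729 / 45984 : ℂ) * h
    simpa using this
  subst hk
  exact ⟨rfl, by linear_combination h / 8748⟩

theorem coeff_ten_of_diagonal {a m l₆ k₁₀ k₁₂ : ℂ}
    (hP : twist 3 P = form ![0, 0, 0, 3 * a, 0, l₆, -6 * m, 3 * a ^ 2 + 3 * m, k₁₀, k₁₂])
    (hG : IsAlgebraicGroup 3 P) : k₁₀ = a * l₆ := by
  have h : 26244 * (k₁₀ - a * l₆) = 0 := by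
    have h := quad_swap_vec hP hG 6 1 (-1) 2 1 (by norm_num)
    simp only [map_neg, map_ofNat, map_zero, map_mul, map_add, map_pow, Int.cast_one, Int.cast_neg,
      Int.cast_ofNat] at h
    rw [quad_diagonal_order_five _ _ _ _ _ _ (root_pow_self 6)] at h
    refine eq_zero_of_of_mul_root_pow (N := 6) (j := 5) (by norm_num) ?_
    simp only [map_neg, map_ofNat, map_mul, map_add, map_sub, map_pow]
    linear_combination h
  linear_combination h / 26244

theorem coeff_twelve_of_diagonal {a m l₆ k₁₂ : ℂ}
    (hP : twist 3 P = form ![0, 0, 0, 3 * a, 0, l₆, -6 * m, 3 * a ^ 2 + 3 * m, a * l₆, k₁₂])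
    (hG : IsAlgebraicGroup 3 P) : l₆ = 0 ∧ k₁₂ = a ^ 3 + a * m := by
  have h : 34992 * l₆ ^ 2 + 78732 * (a ^ 3 + a * m - k₁₂) = 0 := by
    have h := quad_swap_vec hP hG 7 1 (-1) 2 1 (by norm_num)
    simp only [map_neg, map_ofNat, map_zero, map_mul, map_add, map_pow, Int.cast_one, Int.cast_neg,
      Int.cast_ofNat] at h
    rw [quad_diagonal_order_six _ _ _ _ _ (root_pow_self 7)] at h
    refine eq_zero_of_of_mul_root_pow (N := 7) (j := 6) (by norm_num) ?_
    simp only [map_neg, map_ofNat, map_mul, map_add, map_sub, map_pow]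
    linear_combination h
  have h' : -30336 * l₆ ^ 2 - 55296 * (a ^ 3 + a * m - k₁₂) = 0 := by
    have h := quad_swap_vec hP hG 7 1 1 2 (-2) (by norm_num)
    simp only [map_neg, map_ofNat, map_zero, map_mul, map_add, map_pow, Int.cast_one, Int.cast_neg,
      Int.cast_ofNat] at h
    rw [quad_diagonal_order_six' _ _ _ _ _ (root_pow_self 7)] at h
    refine eq_zero_of_of_mul_root_pow (N := 7) (j := 6) (by norm_num) ?_
    simp only [map_neg, map_ofNat, map_mul, map_add, map_sub, map_pow]
    linear_combination h
  have hl : l₆ = 0 := by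
    have : l₆ ^ 2 = 0 := by
      linear_combination (-1 / 5760 : ℂ) * h' - (55296 / 78732 / 5760 : ℂ) * h
    simpa using this
  subst hl
  exact ⟨rfl, by linear_combination -h / 78732⟩

theorem coeff_eight_of_diagonal {a m : ℂ}
    (hP : twist 3 P = form ![0, 0, 0, 3 * a, 0, 0, -6 * m, 3 * a ^ 2 + 3 * m, 0, a ^ 3 + a * m])
    (hG : IsAlgebraicGroup 3 P) : m = 0 := by
  have h : 3779136 * m ^ 2 = 0 := by
    have h := quad_swap_vec hP hG 9 1 (-1) 2 1 (by norm_num)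
    simp only [map_neg, map_ofNat, map_zero, map_mul, map_add, map_pow, Int.cast_one, Int.cast_neg,
      Int.cast_ofNat] at h
    rw [quad_diagonal_order_eight _ _ _ (root_pow_self 9)] at h
    refine eq_zero_of_of_mul_root_pow (N := 9) (j := 8) (by norm_num) ?_
    simp only [map_neg, map_ofNat, map_mul, map_add, map_sub, map_pow]
    linear_combination h
  simpa using h

theorem coeff_zero_cases {k₀ k₂ k₄ l₄ k₆ l₆ k₈ l₈ k₁₀ k₁₂ : ℂ}
    (hP : twist 3 P = form ![k₀, k₂, k₄, l₄, k₆, l₆, k₈, l₈, k₁₀, k₁₂])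
    (hG : IsAlgebraicGroup 3 P) : k₀ = -27 ∨ k₀ = 0 := by
  have key : k₀ ^ 2 * (k₀ + 27) = 0 := by
    by_cases h4 : k₀ = 4
    · have h := quad_swap_vec hP hG 1 1 1 2 (-2) (by rw [h4]; norm_num)
      simp only [Int.cast_one, Int.cast_neg, Int.cast_ofNat] at h
      rw [quad_order_zero' _ _ _ _ _ _ _ _ _ _ _ (root_pow_self 1)] at h
      have : -96 * (k₀ ^ 2 * (k₀ + 27)) = 0 := by
        refine eq_zero_of_of_mul_root_pow (N := 1) (j := 0) (by norm_num) ?_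
        simp only [map_neg, map_ofNat, map_mul, map_add, map_sub, map_pow]
        linear_combination h
      linear_combination -this / 96
    · have h := quad_swap_vec hP hG 1 1 (-1) 2 1 fun h => h4 (by
        push_cast at h
        linear_combination -h / 2)
      simp only [Int.cast_one, Int.cast_neg, Int.cast_ofNat] at h
      rw [quad_order_zero _ _ _ _ _ _ _ _ _ _ _ (root_pow_self 1)] at h
      have : 108 * (k₀ ^ 2 * (k₀ + 27)) = 0 := by
        refine eq_zero_of_of_mul_root_pow (N := 1) (j := 0) (by norm_num) ?_
        simp only [map_neg, map_ofNat, map_mul, map_add, map_sub, map_pow]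
        linear_combination h
      linear_combination this / 108
  rcases mul_eq_zero.1 key with h | h
  · exact Or.inr (by simpa using h)
  · exact Or.inl (by linear_combination h)

/-- The elliptic class of coefficients. -/
theorem coeffs_of_elliptic {k₂ k₄ l₄ k₆ l₆ k₈ l₈ k₁₀ k₁₂ : ℂ}
    (hP : twist 3 P = form ![-27, k₂, k₄, l₄, k₆, l₆, k₈, l₈, k₁₀, k₁₂])
    (hG : IsAlgebraicGroup 3 P) :
    ∃ c, twist 3 P = form ![-27, 0, -54 * c, 18 * c, 0, 0, -27 * c ^ 2, 81 * c ^ 2, 0, 0] := by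
  obtain rfl := coeff_two_of_elliptic hP hG
  obtain rfl := coeff_four_of_elliptic hP hG
  obtain ⟨c, rfl⟩ : ∃ c, l₄ = 18 * c := ⟨l₄ / 18, by ring⟩
  rw [show -3 * (18 * c) = -54 * c by ring] at hP
  obtain ⟨rfl, rfl⟩ := coeff_six_of_elliptic hP hG
  obtain ⟨rfl, rfl⟩ := coeff_eight_of_elliptic hP hG
  obtain rfl := coeff_ten_of_elliptic hP hG
  obtain rfl := coeff_twelve_of_elliptic hP hG
  exact ⟨c, hP⟩

/-- The diagonal class of coefficients. -/
theorem coeffs_of_diagonal {k₂ k₄ l₄ k₆ l₆ k₈ l₈ k₁₀ k₁₂ : ℂ}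
    (hP : twist 3 P = form ![0, k₂, k₄, l₄, k₆, l₆, k₈, l₈, k₁₀, k₁₂])
    (hG : IsAlgebraicGroup 3 P) :
    ∃ a, twist 3 P = form ![0, 0, 0, 3 * a, 0, 0, 0, 3 * a ^ 2, 0, a ^ 3] := by
  obtain rfl := coeff_two_of_diagonal hP hG
  obtain rfl := coeff_six_of_diagonal hP hG
  obtain ⟨rfl, h8⟩ := coeff_four_of_diagonal hP hG
  obtain ⟨a, rfl⟩ : ∃ a, l₄ = 3 * a := ⟨l₄ / 3, by ring⟩
  obtain ⟨m, rfl⟩ : ∃ m, l₈ = 3 * a ^ 2 + 3 * m := ⟨l₈ / 3 - a ^ 2, by ring⟩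
  obtain rfl : k₈ = -6 * m := by linear_combination h8 / 3
  obtain rfl := coeff_ten_of_diagonal hP hG
  obtain ⟨rfl, rfl⟩ := coeff_twelve_of_diagonal hP hG
  rw [mul_zero] at hP
  obtain rfl := coeff_eight_of_diagonal hP hG
  refine ⟨a, ?_⟩
  simpa using hP

end Necessity

/-! ### Coset groups -/

section Coset

variable {G : Type*} [Group G]

theorem cosetMul_mk (H : Subgroup (MulAut G)) [Finite H] [Fintype H] (u v : G) :
    cosetMul H (Quotient.mk _ u) (Quotient.mk _ v) =
      (Finset.univ : Finset H).val.map fun h => Quotient.mk _ (u * h.1 v) := by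
  obtain rfl : ‹Fintype H› = Fintype.ofFinite H := Subsingleton.elim _ _
  rfl

theorem cosetMul_assoc (H : Subgroup (MulAut G)) [Finite H]
    (a b d : MulAction.orbitRel.Quotient H G) :
    ((cosetMul H a b).bind fun w => cosetMul H w d) =
      (cosetMul H b d).bind fun w => cosetMul H a w := by
  let : Fintype H := Fintype.ofFinite H
  induction a using Quotient.inductionOn with | _ u
  induction b using Quotient.inductionOn with | _ v
  induction d using Quotient.inductionOn with | _ w
  simp only [cosetMul_mk, Multiset.bind_map]
  conv_rhs => rw [Multiset.bind_map_comm]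
  refine Multiset.bind_congr fun h _ => ?_
  refine Multiset.map_eq_map_of_bij_of_nodup _ _ Finset.univ.nodup Finset.univ.nodup
    (fun k _ => h⁻¹ * k) (fun _ _ => Finset.mem_univ _) (fun a _ b _ hab => by simpa using hab)
    (fun b _ => ⟨h * b, Finset.mem_univ _, by group⟩) (fun k _ => ?_)
  simp [mul_assoc]

theorem univ_val_zpowers_of_orderOf_eq_three {τ : G} (hτ : orderOf τ = 3)
    [Fintype (Subgroup.zpowers τ)] :
    (Finset.univ : Finset (Subgroup.zpowers τ)).val.map (fun h => h.1) = {1, τ, τ ^ 2} := by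
  have hcard : Fintype.card (Subgroup.zpowers τ) = 3 := by
    rw [← Nat.card_eq_fintype_card, Nat.card_zpowers, hτ]
  have hne : ∀ i j : ℕ, i < 3 → j < 3 → i ≠ j → τ ^ i ≠ τ ^ j := fun i j hi hj h e =>
    h (pow_injOn_Iio_orderOf (by rwa [hτ]) (by rwa [hτ]) e)
  have hnd : ({1, τ, τ ^ 2} : Multiset G).Nodup := by
    have h1 := hne 0 1 (by norm_num) (by norm_num) (by norm_num)
    have h2 := hne 0 2 (by norm_num) (by norm_num) (by norm_num)
    have h3 := hne 1 2 (by norm_num) (by norm_num) (by norm_num)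
    rw [pow_zero, pow_one] at h1
    rw [pow_zero] at h2
    rw [pow_one] at h3
    simp [h1, h2, h3]
  symm
  refine Multiset.eq_of_le_of_card_le ((Multiset.le_iff_subset hnd).2 fun x hx => ?_) ?_
  · simp only [Multiset.insert_eq_cons, Multiset.mem_cons, Multiset.mem_singleton] at hx
    refine Multiset.mem_map.2 ⟨⟨x, ?_⟩, Finset.mem_univ_val _, rfl⟩
    rcases hx with rfl | rfl | rfl
    · exact one_mem _
    · exact Subgroup.mem_zpowers _
    · exact pow_mem (Subgroup.mem_zpowers _) 2
  · simp [hcard]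

theorem cosetMul_zpowers {τ : MulAut G} (hτ : orderOf τ = 3) [Finite (Subgroup.zpowers τ)]
    (u v : G) : cosetMul (Subgroup.zpowers τ) (Quotient.mk _ u) (Quotient.mk _ v) =
      {Quotient.mk _ (u * v), Quotient.mk _ (u * τ v), Quotient.mk _ (u * τ (τ v))} := by
  let : Fintype (Subgroup.zpowers τ) := Fintype.ofFinite _
  rw [cosetMul_mk]
  have h := congrArg (Multiset.map fun h : MulAut G =>
    (Quotient.mk (MulAction.orbitRel (Subgroup.zpowers τ) G) (u * h v)))
    (univ_val_zpowers_of_orderOf_eq_three hτ)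
  rw [Multiset.map_map] at h
  refine h.trans ?_
  simp [pow_two]

end Coset

/-! ### The automorphism of order three -/

/-- The primitive third root of unity `exp (2πi/3)`. -/
def omega : ℂ := Complex.exp (2 * Real.pi * Complex.I / 3)

theorem omega_isPrimitiveRoot : IsPrimitiveRoot omega 3 := by
  have := Complex.isPrimitiveRoot_exp 3 (by norm_num)
  simpa [omega] using this

theorem omega_pow_three : omega ^ 3 = 1 := omega_isPrimitiveRoot.pow_eq_one

theorem omega_ne_one : omega ≠ 1 := omega_isPrimitiveRoot.ne_one (by norm_num)

theorem omega_ne_zero : omega ≠ 0 := omega_isPrimitiveRoot.ne_zero (by norm_num)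

theorem omega_sq : omega ^ 2 = -1 - omega := by
  have h : (omega - 1) * (omega ^ 2 + omega + 1) = 0 := by
    linear_combination omega_pow_three
  have := (mul_eq_zero.1 h).resolve_left (sub_ne_zero.2 omega_ne_one)
  linear_combination this

theorem eq_omega_mul_of_pow_three_eq {x y : ℂ} (h : y ^ 3 = x ^ 3) :
    y = x ∨ y = omega * x ∨ y = omega * (omega * x) := by
  have : (y - x) * ((y - omega * x) * (y - omega * (omega * x))) = 0 := by
    linear_combination h - x ^ 3 * omega_pow_three + (x ^ 2 * y * omega - y ^ 2 * x) * omega_sq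
  rcases mul_eq_zero.1 this with h | h
  · exact Or.inl (sub_eq_zero.1 h)
  · rcases mul_eq_zero.1 h with h | h
    · exact Or.inr (Or.inl (sub_eq_zero.1 h))
    · exact Or.inr (Or.inr (sub_eq_zero.1 h))

section Curve

open WeierstrassCurve.Affine

variable {c : ℂ}

theorem curve_equation_iff {x y : ℂ} : (curve c).Equation x y ↔ y ^ 2 = x ^ 3 + c := by
  rw [WeierstrassCurve.Affine.equation_iff]
  simp [curve]

theorem curve_nonsingular_iff {x y : ℂ} :
    (curve c).Nonsingular x y ↔ y ^ 2 = x ^ 3 + c ∧ (x ≠ 0 ∨ y ≠ 0) := by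
  rw [WeierstrassCurve.Affine.nonsingular_iff', curve_equation_iff]
  simp [curve]

theorem curve_negY (x y : ℂ) : (curve c).negY x y = -y := by
  simp [negY, curve]

theorem curve_addX (x₁ x₂ l : ℂ) : (curve c).addX x₁ x₂ l = l ^ 2 - x₁ - x₂ := by
  simp [addX, curve]

theorem curve_addY (x₁ x₂ y₁ l : ℂ) :
    (curve c).addY x₁ x₂ y₁ l = -(l * (l ^ 2 - x₁ - x₂ - x₁) + y₁) := by
  simp [addY, negAddY, addX, negY, curve]

theorem curve_slope_self {x y : ℂ} (hy : y ≠ 0) :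
    (curve c).slope x x y y = 3 * x ^ 2 / (2 * y) := by
  have : y ≠ (curve c).negY x y := by
    rw [curve_negY]
    exact fun h => hy (self_eq_neg.1 h)
  rw [slope_of_Y_ne rfl this, curve_negY]
  simp [curve, two_mul]

theorem omega_mul_nonsingular {x y : ℂ} (h : (curve c).Nonsingular x y) :
    (curve c).Nonsingular (omega * x) y := by
  rw [curve_nonsingular_iff] at h ⊢
  refine ⟨by rw [mul_pow, omega_pow_three, one_mul, h.1], ?_⟩
  simpa [omega_ne_zero] using h.2

/-- The map `(x, y) ↦ (ω x, y)` on the points of the curve `y² = x³ + c`. -/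
def rotate : (curve c).Point → (curve c).Point
  | .zero => .zero
  | .some x y h => .some (omega * x) y (omega_mul_nonsingular h)

theorem rotate_zero : rotate (0 : (curve c).Point) = 0 := rfl

theorem rotate_some {x y : ℂ} (h : (curve c).Nonsingular x y) :
    rotate (.some x y h) = .some (omega * x) y (omega_mul_nonsingular h) := rfl

theorem rotate_rotate_rotate (A : (curve c).Point) : rotate (rotate (rotate A)) = A := by
  rcases A with _ | ⟨x, y, h⟩
  · rfl
  · simp only [rotate_some, Point.some.injEq, and_true]
    linear_combination x * omega_pow_three

theorem slope_omega_mul (x₁ x₂ y₁ y₂ : ℂ) :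
    (curve c).slope (omega * x₁) (omega * x₂) y₁ y₂ =
      omega ^ 2 * (curve c).slope x₁ x₂ y₁ y₂ := by
  by_cases hx : x₁ = x₂
  · subst hx
    by_cases hy : y₁ = -y₂
    · rw [slope_of_Y_eq rfl (by rwa [curve_negY]), slope_of_Y_eq rfl (by rwa [curve_negY]),
        mul_zero]
    · rw [slope_of_Y_ne rfl (by rwa [curve_negY]), slope_of_Y_ne rfl (by rwa [curve_negY])]
      simp only [curve_negY]
      simp [curve]
      ring
  · have hx' : omega * x₁ ≠ omega * x₂ := fun h => hx (mul_left_cancel₀ omega_ne_zero h)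
    rw [slope_of_X_ne hx, slope_of_X_ne hx', ← mul_sub]
    have : x₁ - x₂ ≠ 0 := sub_ne_zero.2 hx
    have := omega_ne_zero
    field_simp
    linear_combination -(y₁ - y₂) * omega_pow_three

theorem rotate_add (A B : (curve c).Point) : rotate (A + B) = rotate A + rotate B := by
  rcases A with _ | ⟨x₁, y₁, h₁⟩
  · change rotate (0 + B) = 0 + rotate B
    rw [zero_add, zero_add]
  rcases B with _ | ⟨x₂, y₂, h₂⟩
  · change rotate (_ + 0) = rotate _ + 0
    rw [add_zero, add_zero]
  by_cases hxy : x₁ = x₂ ∧ y₁ = (curve c).negY x₂ y₂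
  · rw [Point.add_of_Y_eq hxy.1 hxy.2, rotate_some, rotate_some,
      Point.add_of_Y_eq (by rw [hxy.1]) (by rw [hxy.2, curve_negY, curve_negY]), rotate_zero]
  · have hxy' : ¬(omega * x₁ = omega * x₂ ∧ y₁ = (curve c).negY (omega * x₂) y₂) := by
      rw [curve_negY] at hxy ⊢
      exact fun h => hxy ⟨mul_left_cancel₀ omega_ne_zero h.1, h.2⟩
    rw [Point.add_some hxy, rotate_some, rotate_some, rotate_some, Point.add_some hxy']
    simp only [Point.some.injEq, slope_omega_mul, curve_addX, curve_addY]
    generalize (curve c).slope x₁ x₂ y₁ y₂ = l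
    constructor
    · linear_combination -l ^ 2 * omega * omega_pow_three
    · linear_combination (l ^ 3 * (omega ^ 3 + 1) - l * (x₁ + x₂ + x₁)) * omega_pow_three

/-- The automorphism `(x, y) ↦ (ω x, y)` of the group of points of the curve `y² = x³ + c`. -/
def rotateAut (c : ℂ) : MulAut (Multiplicative (curve c).Point) :=
  AddEquiv.toMultiplicative
    { toFun := rotate
      invFun := fun A => rotate (rotate A)
      left_inv := rotate_rotate_rotate
      right_inv := rotate_rotate_rotate
      map_add' := rotate_add }

theorem rotateAut_ofAdd (A : (curve c).Point) :
    rotateAut c (Multiplicative.ofAdd A) = Multiplicative.ofAdd (rotate A) := rfl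

theorem orderOf_rotateAut (c : ℂ) : orderOf (rotateAut c) = 3 := by
  refine orderOf_eq_prime ?_ fun h => ?_
  · ext A
    exact congrArg Multiplicative.ofAdd (rotate_rotate_rotate (Multiplicative.toAdd A))
  · obtain ⟨y, hy⟩ := IsAlgClosed.exists_pow_nat_eq (1 + c) (n := 2) (by norm_num)
    have hn : (curve c).Nonsingular 1 y :=
      curve_nonsingular_iff.2 ⟨by rw [hy]; ring, Or.inl one_ne_zero⟩
    have h1 := congrArg Multiplicative.toAdd
      (DFunLike.congr_fun h (Multiplicative.ofAdd (Point.some 1 y hn)))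
    rw [rotateAut_ofAdd, toAdd_ofAdd, rotate_some] at h1
    have h2 : omega * 1 = 1 := (Point.some.inj h1).1
    exact omega_ne_one (by simpa using h2)

end Curve

section Elliptic

open WeierstrassCurve.Affine

variable {c : ℂ}

theorem eval_slice_elliptic {P : MvPolynomial (Fin 3) ℂ} (hP : twist 3 P = lawElliptic c)
    (u v z : ℂ) : (slice P u v).eval z = (z - u - v) ^ 3 - 27 * (u * v * z)
      + 18 * c * (z - u - v) ^ 2 * (u * v * z)
      - 54 * c * (u * v - u * z - v * z) * (u * v * z)
      - 27 * c ^ 2 * (u * v - u * z - v * z) ^ 2 * (u * v * z)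
      + 81 * c ^ 2 * (z - u - v) * (u * v * z) ^ 2 := by
  rw [eval_slice_three, hP, lawElliptic]
  have : (27 : MvPolynomial (Fin 3) ℂ) = C 27 := (map_ofNat C 27).symm
  simp only [this, map_add, map_sub, map_mul, map_pow, eval_C, eval_sigma_one, eval_sigma_two,
    eval_sigma_three]
  ring

/-- The monic linear polynomial with root `p`, and `1` for `p = ∞`. -/
def lin (p : OnePoint ℂ) : Polynomial ℂ :=
  p.elim 1 fun w => Polynomial.X - Polynomial.C w

theorem lin_infty : lin OnePoint.infty = 1 := rfl

theorem lin_coe (w : ℂ) : lin (w : OnePoint ℂ) = Polynomial.X - Polynomial.C w := rfl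

theorem invY_zero : invY c (0 : (curve c).Point) = ((0 : ℂ) : OnePoint ℂ) := rfl

theorem invY_some {x y : ℂ} (h : (curve c).Nonsingular x y) :
    invY c (.some x y h) = if y = 0 then OnePoint.infty else ((y⁻¹ : ℂ) : OnePoint ℂ) := rfl

theorem invY_some_eq_coe_iff {x y u : ℂ} {h : (curve c).Nonsingular x y} :
    invY c (.some x y h) = (u : OnePoint ℂ) ↔ y ≠ 0 ∧ u = y⁻¹ := by
  rw [invY_some]
  split_ifs with hy
  · simp [hy]
  · rw [OnePoint.coe_eq_coe]
    exact ⟨fun h => ⟨hy, h.symm⟩, fun h => h.2.symm⟩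

theorem invY_rotate (A : (curve c).Point) : invY c (rotate A) = invY c A := by
  cases A <;> rfl

theorem exists_eval_lin {x y n d : ℂ} (h : (curve c).Nonsingular x y) (hd : d ≠ 0)
    (hn : y * d = n) :
    ∃ k : ℂ, k ≠ 0 ∧ ∀ z, n * z - d = k * (lin (invY c (.some x y h))).eval z := by
  rw [invY_some]
  split_ifs with hy
  · refine ⟨-d, neg_ne_zero.2 hd, fun z => ?_⟩
    rw [lin_infty, ← hn, hy]
    simp
  · refine ⟨n, by rw [← hn]; exact mul_ne_zero hy hd, fun z => ?_⟩
    rw [lin_coe, ← hn]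
    simp only [Polynomial.eval_sub, Polynomial.eval_X, Polynomial.eval_C]
    field_simp

/-- `d³` times the second coordinate of the sum of two points, where `d` is the difference of the
first coordinates of the points. -/
def addNum (x₁ y₁ x₂ y₂ : ℂ) : ℂ :=
  -y₁ * (x₂ - x₁) ^ 3 - (y₂ - y₁) ^ 3 + (y₂ - y₁) * (x₂ - x₁) ^ 2 * (2 * x₁ + x₂)

theorem exists_eval_lin_add {x₁ y₁ x₂ y₂ : ℂ} (h₁ : (curve c).Nonsingular x₁ y₁)
    (h₂ : (curve c).Nonsingular x₂ y₂) (hx : x₁ ≠ x₂) :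
    ∃ k : ℂ, k ≠ 0 ∧ ∀ z, addNum x₁ y₁ x₂ y₂ * z - (x₂ - x₁) ^ 3 =
      k * (lin (invY c (Point.some x₁ y₁ h₁ + Point.some x₂ y₂ h₂))).eval z := by
  have hd : x₂ - x₁ ≠ 0 := sub_ne_zero.2 hx.symm
  rw [Point.add_some fun h => hx h.1]
  refine exists_eval_lin _ (pow_ne_zero 3 hd) ?_
  have hs : (curve c).slope x₁ x₂ y₁ y₂ = (y₂ - y₁) / (x₂ - x₁) := by
    rw [slope_of_X_ne hx, ← neg_sub y₂, ← neg_sub x₂, neg_div_neg_eq]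
  rw [curve_addY, hs, addNum]
  field_simp
  ring

theorem exists_eval_lin_add_self {x y : ℂ} (h : (curve c).Nonsingular x y) (hy : y ≠ 0) :
    ∃ k : ℂ, k ≠ 0 ∧ ∀ z, (36 * x ^ 3 * y ^ 2 - 27 * x ^ 6 - 8 * y ^ 4) * z - 8 * y ^ 3 =
      k * (lin (invY c (Point.some x y h + Point.some x y h))).eval z := by
  have hne : ¬(x = x ∧ y = (curve c).negY x y) := by
    rw [curve_negY]
    exact fun h => hy (self_eq_neg.1 h.2)
  rw [Point.add_some hne]
  refine exists_eval_lin _ (mul_ne_zero (by norm_num) (pow_ne_zero 3 hy)) ?_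
  rw [curve_addY, curve_slope_self hy]
  field_simp
  ring

theorem exists_eval_lin_add_rotate {x x' y : ℂ} (h : (curve c).Nonsingular x y)
    (h' : (curve c).Nonsingular x' y) (hx : x ≠ x') (hy : y ≠ 0) :
    invY c (Point.some x y h + Point.some x' y h') = ((-y⁻¹ : ℂ) : OnePoint ℂ) := by
  rw [Point.add_some fun h => hx h.1, invY_some_eq_coe_iff, curve_addY, slope_of_X_ne hx]
  simp [hy, inv_neg]

/-- The polynomial of the law at `u`, `v` is the product of the linear polynomials with roots
`1 / y` at the points `A + τ^i B`, up to a constant. -/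
def Factors (A B : (curve c).Point) : Prop :=
  ∀ P : MvPolynomial (Fin 3) ℂ, twist 3 P = lawElliptic c → ∀ u v : ℂ,
    invY c A = (u : OnePoint ℂ) → invY c B = (v : OnePoint ℂ) →
    ∃ k : ℂ, k ≠ 0 ∧ ∀ z, (slice P u v).eval z = k * ((lin (invY c (A + B))).eval z *
      (lin (invY c (A + rotate B))).eval z * (lin (invY c (A + rotate (rotate B)))).eval z)

theorem Factors.of_rotate {A B : (curve c).Point} (h : Factors A (rotate B)) : Factors A B := by
  intro P hP u v hu hv
  obtain ⟨k, hk, h⟩ := h P hP u v hu (by rwa [invY_rotate])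
  refine ⟨k, hk, fun z => ?_⟩
  rw [h, rotate_rotate_rotate]
  ring

theorem factors_zero_left (B : (curve c).Point) : Factors 0 B := by
  intro P hP u v hu hv
  rw [invY_zero, OnePoint.coe_eq_coe] at hu
  subst hu
  refine ⟨1, one_ne_zero, fun z => ?_⟩
  simp only [zero_add, invY_rotate, hv]
  rw [lin_coe, eval_slice_elliptic hP]
  simp only [Polynomial.eval_sub, Polynomial.eval_X, Polynomial.eval_C]
  ring

theorem factors_zero_right (A : (curve c).Point) : Factors A 0 := by
  intro P hP u v hu hv
  rw [invY_zero, OnePoint.coe_eq_coe] at hv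
  subst hv
  refine ⟨1, one_ne_zero, fun z => ?_⟩
  rw [rotate_zero, rotate_zero, add_zero, hu, lin_coe, eval_slice_elliptic hP]
  simp only [Polynomial.eval_sub, Polynomial.eval_X, Polynomial.eval_C]
  ring

theorem norm_eq (a b d x : ℂ) :
    (a + b * x + d * x ^ 2) * (a + b * (omega * x) + d * (omega * x) ^ 2) *
      (a + b * (omega * (omega * x)) + d * (omega * (omega * x)) ^ 2) =
    a ^ 3 + b ^ 3 * x ^ 3 + d ^ 3 * (x ^ 3) ^ 2 - 3 * (a * b * d) * x ^ 3 := by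
  have h : (a + b * (omega * x) + d * (omega * x) ^ 2) *
      (a + b * (omega * (omega * x)) + d * (omega * (omega * x)) ^ 2) =
      a ^ 2 + b ^ 2 * x ^ 2 + d ^ 2 * x ^ 4 - a * b * x - a * d * x ^ 2 - b * d * x ^ 3 := by
    linear_combination (a * b * x + a * d * x ^ 2 + b * d * x ^ 3) * omega_sq +
      (a * d * x ^ 2 * omega + b ^ 2 * x ^ 2 + b * d * x ^ 3 * (omega + omega ^ 2)
        + d ^ 2 * x ^ 4 * (omega ^ 3 + 1)) * omega_pow_three
  rw [mul_assoc, h]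
  ring

theorem addNum_eq {x₁ y₁ x₂ y₂ : ℂ} (h : x₂ ^ 3 = x₁ ^ 3 + (y₂ - y₁) * (y₁ + y₂)) (z : ℂ) :
    addNum x₁ y₁ x₂ y₂ * z - (x₂ - x₁) ^ 3 =
      (y₂ - y₁) * (z * (2 * y₁ * (y₂ - y₁) + 3 * x₁ ^ 3) - (1 + y₁ * z) * (y₁ + y₂))
        + -3 * x₁ ^ 2 * (1 + y₂ * z) * x₂ + 3 * x₁ * (1 + y₁ * z) * x₂ ^ 2 := by
  unfold addNum
  linear_combination (z * (y₂ - y₁) - (1 + y₁ * z)) * h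

theorem factors_generic {x₁ y₁ x₂ y₂ : ℂ} (h₁ : (curve c).Nonsingular x₁ y₁)
    (h₂ : (curve c).Nonsingular x₂ y₂) (hy : y₁ ^ 2 ≠ y₂ ^ 2) :
    Factors (Point.some x₁ y₁ h₁) (Point.some x₂ y₂ h₂) := by
  intro P hP u v hu hv
  obtain ⟨hy₁, rfl⟩ := invY_some_eq_coe_iff.1 hu
  obtain ⟨hy₂, rfl⟩ := invY_some_eq_coe_iff.1 hv
  have e₁ := (curve_nonsingular_iff.1 h₁).1
  have e₂ := (curve_nonsingular_iff.1 h₂).1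
  have e : x₂ ^ 3 = x₁ ^ 3 + (y₂ - y₁) * (y₁ + y₂) := by linear_combination e₁ - e₂
  have e' : (omega * x₂) ^ 3 = x₁ ^ 3 + (y₂ - y₁) * (y₁ + y₂) := by
    rw [mul_pow, omega_pow_three, one_mul, e]
  have e'' : (omega * (omega * x₂)) ^ 3 = x₁ ^ 3 + (y₂ - y₁) * (y₁ + y₂) := by
    rw [mul_pow, omega_pow_three, one_mul, e']
  have hne : ∀ x, x ^ 3 = x₁ ^ 3 + (y₂ - y₁) * (y₁ + y₂) → x₁ ≠ x := by
    rintro x hx rfl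
    exact hy (by linear_combination hx)
  have hL : y₂ - y₁ ≠ 0 := fun h => hy (by linear_combination (-y₁ - y₂) * h)
  obtain ⟨k, hk, h⟩ := exists_eval_lin_add h₁ h₂ (hne _ e)
  obtain ⟨k', hk', h'⟩ := exists_eval_lin_add h₁ (omega_mul_nonsingular h₂) (hne _ e')
  obtain ⟨k'', hk'', h''⟩ := exists_eval_lin_add h₁
    (omega_mul_nonsingular (omega_mul_nonsingular h₂)) (hne _ e'')
  refine ⟨k * k' * k'' / ((y₂ - y₁) ^ 3 * y₁ ^ 3 * y₂ ^ 3), by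
    have := mul_ne_zero (mul_ne_zero hk hk') hk''
    positivity, fun z => ?_⟩
  rw [rotate_some, rotate_some, div_mul_eq_mul_div, eq_div_iff (by positivity)]
  have key := norm_eq ((y₂ - y₁) * (z * (2 * y₁ * (y₂ - y₁) + 3 * x₁ ^ 3)
    - (1 + y₁ * z) * (y₁ + y₂))) (-3 * x₁ ^ 2 * (1 + y₂ * z)) (3 * x₁ * (1 + y₁ * z)) x₂
  rw [← addNum_eq e, ← addNum_eq e', ← addNum_eq e'', h, h', h'', e] at key
  obtain rfl : c = y₁ ^ 2 - x₁ ^ 3 := by linear_combination -e₁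
  have hE : (slice P y₁⁻¹ y₂⁻¹).eval z * ((y₂ - y₁) ^ 3 * y₁ ^ 3 * y₂ ^ 3) =
      (y₂ - y₁) ^ 3 * ((y₁ * y₂ * z - y₁ - y₂) ^ 3 - 27 * z * (y₁ * y₂) ^ 2
      + 18 * (y₁ ^ 2 - x₁ ^ 3) * (y₁ * y₂ * z - y₁ - y₂) ^ 2 * z
      - 54 * (y₁ ^ 2 - x₁ ^ 3) * (1 - (y₁ + y₂) * z) * z * (y₁ * y₂)
      - 27 * (y₁ ^ 2 - x₁ ^ 3) ^ 2 * (1 - (y₁ + y₂) * z) ^ 2 * z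
      + 81 * (y₁ ^ 2 - x₁ ^ 3) ^ 2 * (y₁ * y₂ * z - y₁ - y₂) * z ^ 2) := by
    rw [eval_slice_elliptic hP]
    field_simp
    ring
  rw [hE]
  linear_combination -key

theorem factors_self (A : (curve c).Point) : Factors A A := by
  rcases A with _ | ⟨x, y, h⟩
  · exact factors_zero_left _
  intro P hP u v hu hv
  obtain ⟨hy, rfl⟩ := invY_some_eq_coe_iff.1 hu
  obtain ⟨-, rfl⟩ := invY_some_eq_coe_iff.1 hv
  have e := (curve_nonsingular_iff.1 h).1
  obtain ⟨k, hk, hs⟩ := exists_eval_lin_add_self h hy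
  have h' : ∀ (x' : ℂ) (h' : (curve c).Nonsingular x' y), x = 0 ∧ x' = 0 ∨ x ≠ x' →
      invY c (Point.some x y h + Point.some x' y h') = ((-y⁻¹ : ℂ) : OnePoint ℂ) := by
    rintro x' h' (⟨rfl, rfl⟩ | hx)
    · have hne : ¬((0 : ℂ) = 0 ∧ y = (curve c).negY 0 y) := by
        rw [curve_negY]
        exact fun h => hy (self_eq_neg.1 h.2)
      rw [Point.add_some hne, invY_some_eq_coe_iff, curve_addY, curve_slope_self hy]
      simp [hy, inv_neg]
    · exact exists_eval_lin_add_rotate h h' hx hy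
  have hω : omega ^ 2 ≠ 1 :=
    omega_isPrimitiveRoot.pow_ne_one_of_pos_of_lt (by norm_num) (by norm_num)
  have h1 := h' _ (omega_mul_nonsingular h) (by
    by_cases hx : x = 0
    · exact Or.inl ⟨hx, by rw [hx, mul_zero]⟩
    · exact Or.inr fun hc => omega_ne_one (mul_right_cancel₀ hx (by rw [← hc, one_mul])))
  have h2 := h' _ (omega_mul_nonsingular (omega_mul_nonsingular h)) (by
    by_cases hx : x = 0
    · exact Or.inl ⟨hx, by rw [hx, mul_zero, mul_zero]⟩
    · refine Or.inr fun hc => hω (mul_right_cancel₀ hx ?_)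
      rw [one_mul, pow_two, mul_assoc, ← hc])
  refine ⟨k / y ^ 4, div_ne_zero hk (pow_ne_zero 4 hy), fun z => ?_⟩
  rw [rotate_some, rotate_some, h1, h2, lin_coe, div_mul_eq_mul_div, eq_div_iff (by positivity)]
  simp only [Polynomial.eval_sub, Polynomial.eval_X, Polynomial.eval_C]
  rw [← mul_assoc, ← mul_assoc, ← hs, eval_slice_elliptic hP]
  obtain rfl : c = y ^ 2 - x ^ 3 := by linear_combination -e
  field_simp
  ring

theorem curve_neg_nonsingular {x y : ℂ} (h : (curve c).Nonsingular x y) :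
    (curve c).Nonsingular x (-y) := by
  rw [curve_nonsingular_iff] at h ⊢
  simpa using h

theorem factors_neg {x y : ℂ} (h : (curve c).Nonsingular x y) :
    Factors (Point.some x y h) (Point.some x (-y) (curve_neg_nonsingular h)) := by
  intro P hP u v hu hv
  obtain ⟨hy, rfl⟩ := invY_some_eq_coe_iff.1 hu
  obtain ⟨-, rfl⟩ := invY_some_eq_coe_iff.1 hv
  have e := (curve_nonsingular_iff.1 h).1
  have h0 : ∀ (x' : ℂ) (h' : (curve c).Nonsingular x' (-y)), x = x' →
      Point.some x y h + Point.some x' (-y) h' = 0 := fun x' h' hx =>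
    Point.add_of_Y_eq hx (by rw [curve_negY, neg_neg])
  rw [rotate_some, rotate_some, h0 x _ rfl, invY_zero, lin_coe]
  by_cases hx : x = 0
  · rw [h0 _ _ (by rw [hx, mul_zero]), h0 _ _ (by rw [hx, mul_zero, mul_zero]), invY_zero, lin_coe]
    refine ⟨64, by norm_num, fun z => ?_⟩
    rw [eval_slice_elliptic hP]
    obtain rfl : c = y ^ 2 := by rw [hx] at e; linear_combination -e
    simp only [Polynomial.eval_sub, Polynomial.eval_X, Polynomial.eval_C]
    field_simp
    ring
  have hω : omega ^ 2 ≠ 1 :=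
    omega_isPrimitiveRoot.pow_ne_one_of_pos_of_lt (by norm_num) (by norm_num)
  obtain ⟨k, hk, h1⟩ := exists_eval_lin_add h (omega_mul_nonsingular (curve_neg_nonsingular h))
    fun hc => omega_ne_one (mul_right_cancel₀ hx (by rw [← hc, one_mul]))
  obtain ⟨k', hk', h2⟩ := exists_eval_lin_add h
    (omega_mul_nonsingular (omega_mul_nonsingular (curve_neg_nonsingular h)))
    fun hc => hω (mul_right_cancel₀ hx (by rw [one_mul, pow_two, mul_assoc, ← hc]))
  refine ⟨k * k' / y ^ 6, div_ne_zero (mul_ne_zero hk hk') (pow_ne_zero 6 hy), fun z => ?_⟩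
  rw [div_mul_eq_mul_div, eq_div_iff (by positivity)]
  simp only [Polynomial.eval_sub, Polynomial.eval_X, Polynomial.eval_C]
  have key : (addNum x y (omega * x) (-y) * z - (omega * x - x) ^ 3) *
      (addNum x y (omega * (omega * x)) (-y) * z - (omega * (omega * x) - x) ^ 3) =
      (8 * y ^ 3 - 9 * x ^ 3 * y) ^ 2 * z ^ 2 + 27 * x ^ 6 := by
    have k1 : addNum x y (omega * x) (-y) = 8 * y ^ 3 - 9 * x ^ 3 * y := by
      unfold addNum
      linear_combination (-3 * y * x ^ 3) * omega_pow_three + (3 * y * x ^ 3) * omega_sq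
    have k2 : addNum x y (omega * (omega * x)) (-y) = 8 * y ^ 3 - 9 * x ^ 3 * y := by
      unfold addNum
      linear_combination (3 * y * x ^ 3) * (omega - omega ^ 3 - 1) * omega_pow_three +
        (3 * y * x ^ 3) * omega_sq
    have k3 : (omega * x - x) ^ 3 = x ^ 3 * (3 * (2 * omega + 1)) := by
      linear_combination x ^ 3 * omega_pow_three - 3 * x ^ 3 * omega_sq
    have k4 : (omega * (omega * x) - x) ^ 3 = -(x ^ 3 * (3 * (2 * omega + 1))) := by
      linear_combination x ^ 3 * (omega ^ 3 + 1 - 3 * omega) * omega_pow_three + 3 * x ^ 3 *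
      omega_sq
    rw [k1, k2, k3, k4]
    linear_combination (-36 * x ^ 6) * omega_sq
  rw [h1, h2] at key
  refine Eq.trans (b := z * ((8 * y ^ 3 - 9 * x ^ 3 * y) ^ 2 * z ^ 2 + 27 * x ^ 6)) ?_
    (by linear_combination -z * key)
  rw [eval_slice_elliptic hP]
  obtain rfl : c = y ^ 2 - x ^ 3 := by linear_combination -e
  field_simp
  ring

theorem factors (A B : (curve c).Point) : Factors A B := by
  rcases A with _ | ⟨x₁, y₁, h₁⟩
  · exact factors_zero_left B
  rcases B with _ | ⟨x₂, y₂, h₂⟩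
  · exact factors_zero_right _
  by_cases hy : y₁ ^ 2 = y₂ ^ 2
  · have e₁ := (curve_nonsingular_iff.1 h₁).1
    have e₂ := (curve_nonsingular_iff.1 h₂).1
    have hr : ∀ B : (curve c).Point, Factors (Point.some x₁ y₁ h₁) (rotate (rotate B)) →
        Factors (Point.some x₁ y₁ h₁) B := fun B h => h.of_rotate.of_rotate
    have hx : x₁ ^ 3 = x₂ ^ 3 := by linear_combination e₂ - e₁ + hy
    rcases sq_eq_sq_iff_eq_or_eq_neg.1 hy with rfl | hn
    · rcases eq_omega_mul_of_pow_three_eq hx with rfl | rfl | rfl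
      · exact factors_self _
      · exact Factors.of_rotate (factors_self _)
      · exact hr _ (factors_self _)
    · obtain rfl : y₂ = -y₁ := by rw [hn, neg_neg]
      rcases eq_omega_mul_of_pow_three_eq hx with rfl | rfl | rfl
      · exact factors_neg _
      · exact Factors.of_rotate (factors_neg _)
      · exact hr _ (factors_neg _)
  · exact factors_generic h₁ h₂ hy

end Elliptic

/-! ### The axioms other than associativity -/

section Axioms

theorem degreeOf_form_le (κ : Fin 10 → ℂ) (i : Fin 3) : degreeOf i (form κ) ≤ 3 := by
  have hX : ∀ j : Fin 3, degreeOf i (X j : MvPolynomial (Fin 3) ℂ) ≤ if i = j then 1 else 0 :=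
    fun j => by rw [degreeOf_X]
  have hadd : ∀ {p q : MvPolynomial (Fin 3) ℂ} {m : ℕ}, degreeOf i p ≤ m → degreeOf i q ≤ m →
      degreeOf i (p + q) ≤ m := fun hp hq => (degreeOf_add_le _ _ _).trans (max_le hp hq)
  have hmul : ∀ {p q : MvPolynomial (Fin 3) ℂ} {m n : ℕ}, degreeOf i p ≤ m → degreeOf i q ≤ n →
      degreeOf i (p * q) ≤ m + n := fun hp hq => (degreeOf_mul_le _ _ _).trans (add_le_add hp hq)
  have hC : ∀ a : ℂ, degreeOf i (C a : MvPolynomial (Fin 3) ℂ) ≤ 0 := fun a => by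
    rw [degreeOf_C]
  have h1 : degreeOf i (σ 1) ≤ 1 := by
    rw [sigma_one]
    refine hadd (hadd ?_ ?_) ?_ <;> refine (hX _).trans ?_ <;> split_ifs <;> norm_num
  have h2 : degreeOf i (σ 2) ≤ 1 := by
    rw [sigma_two]
    refine hadd (hadd ?_ ?_) ?_ <;> refine (hmul (hX _) (hX _)).trans ?_ <;>
      fin_cases i <;> simp
  have h3 : degreeOf i (σ 3) ≤ 1 := by
    rw [sigma_three]
    refine (hmul (hmul (hX _) (hX _)) (hX _)).trans ?_
    fin_cases i <;> simp
  have hpow : ∀ {p : MvPolynomial (Fin 3) ℂ} (n : ℕ), degreeOf i p ≤ 1 →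
      degreeOf i (p ^ n) ≤ n := fun n hp =>
    (degreeOf_pow_le _ _ _).trans (by simpa using Nat.mul_le_mul_left n hp)
  have hle : ∀ {p : MvPolynomial (Fin 3) ℂ} {m : ℕ}, m ≤ 3 → degreeOf i p ≤ m →
      degreeOf i p ≤ 3 := fun hm hp => hp.trans hm
  rw [form, generalForm]
  refine hadd (hadd (hadd (hadd (hadd (hadd (hadd (hadd (hadd (hadd ?_ ?_) ?_) ?_) ?_) ?_) ?_)
    ?_) ?_) ?_) ?_
  · exact hpow 3 h1
  · exact hle (by norm_num) (hmul (hC _) h3)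
  · exact hle (by norm_num) (hmul (hC _) (hpow 2 h3))
  · exact hle (by norm_num) (hmul (hC _) (hpow 3 h3))
  · exact hle (by norm_num) (hmul (hmul (hC _) h1) h3)
  · exact hle (by norm_num) (hmul (hmul (hC _) h2) h3)
  · exact hle (by norm_num) (hmul (hmul (hmul (hC _) h1) h2) h3)
  · exact hle (by norm_num) (hmul (hmul (hC _) (hpow 2 h1)) h3)
  · exact hle (by norm_num) (hmul (hmul (hC _) (hpow 2 h2)) h3)
  · exact hle (by norm_num) (hmul (hmul (hC _) (hpow 2 h3)) h1)
  · exact hle (by norm_num) (hmul (hmul (hC _) (hpow 2 h3)) h2)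

theorem isSymmetric_form (κ : Fin 10 → ℂ) : (form κ).IsSymmetric := by
  intro e
  have h : ∀ i, rename e (σ i) = σ i := fun i => rename_esymm (Fin 3) ℂ i e
  simp only [form, generalForm, map_add, map_mul, map_pow, rename_C, h]

theorem isSymmetricAlgebraicGroup_of_assoc {P : MvPolynomial (Fin 3) ℂ} {κ : Fin 10 → ℂ}
    (hP : twist 3 P = form κ)
    (h : ∀ x y z, F 3 P 0 x y ≠ 0 → F 3 P 0 y z ≠ 0 →
      (∀ w ∈ rootMul P x y, F 3 P 0 w z ≠ 0) → (∀ w ∈ rootMul P y z, F 3 P 0 x w ≠ 0) →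
      (rootMul P x y).bind (fun w => rootMul P w z) =
        (rootMul P y z).bind (fun w => rootMul P x w)) :
    IsSymmetricAlgebraicGroup 3 P := by
  have hz : ∀ y, slice P 0 y =
      Polynomial.C (F 3 P 0 0 y) * (Polynomial.X - Polynomial.C y) ^ 3 := fun y => by
    refine Polynomial.funext fun z => ?_
    rw [F_zero_eq hP, slice_eq hP]
    simp [gf₀, gf₁, gf₂, gf₃]
    ring
  refine ⟨⟨fun i => ?_, ?_, hz, fun x => ?_, ⟨-Polynomial.X, fun x => ?_⟩, h⟩, ?_⟩
  · rw [← degreeOf_twist 3, hP]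
    exact degreeOf_form_le κ i
  · rw [F_zero_eq hP]
    simp [gf₃]
  · rw [slice_comm hP, F_comm hP, hz]
  · rw [F, F, slice_eq hP, slice_eq hP]
    simp [gf₀]
  · rw [hP]
    exact isSymmetric_form κ

theorem exists_form {P : MvPolynomial (Fin 3) ℂ} (h : IsSymmetricAlgebraicGroup 3 P) :
    ∃ k₀ k₂ k₄ k₆ k₈ k₁₀ k₁₂ l₄ l₆ l₈ : ℂ,
      twist 3 P = generalForm k₀ k₂ k₄ k₆ k₈ k₁₀ k₁₂ l₄ l₆ l₈ := by
  have he : ∀ y z : ℂ, eval ![0, y, z] (twist 3 P) = F 3 P 0 0 (-y) * (z + y) ^ 3 := fun y z => by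
    have := eval_slice_three P 0 (-y) z
    rw [h.1.zero_mul] at this
    simpa using this.symm
  have hF : ∀ z : ℂ, z ≠ 0 → F 3 P 0 0 (-z) = 1 := fun z hz => by
    have := eval_swap h.2 0 0 z
    rw [he, he, neg_zero, h.1.normalized] at this
    refine mul_right_cancel₀ (pow_ne_zero 3 hz) ?_
    linear_combination -this
  refine exists_eq_generalForm h.2 (fun i => (degreeOf_twist 3 P i).trans_le (h.1.degree_le i))
    fun y z => ?_
  rw [he]
  by_cases hy : y = 0
  · rw [hy, neg_zero, h.1.normalized]
    ring
  · rw [hF y hy]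
    ring

theorem generalForm_eq_form (k₀ k₂ k₄ k₆ k₈ k₁₀ k₁₂ l₄ l₆ l₈ : ℂ) :
    generalForm k₀ k₂ k₄ k₆ k₈ k₁₀ k₁₂ l₄ l₆ l₈ =
      form ![k₀, k₂, k₄, l₄, k₆, l₆, k₈, l₈, k₁₀, k₁₂] := rfl

theorem lawElliptic_eq_form (c : ℂ) : lawElliptic c =
    form ![-27, 0, -54 * c, 18 * c, 0, 0, -27 * c ^ 2, 81 * c ^ 2, 0, 0] := by
  have h27 : (27 : MvPolynomial (Fin 3) ℂ) = C 27 := (map_ofNat C 27).symm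
  rw [lawElliptic, ← generalForm_eq_form, generalForm, h27]
  simp only [C_neg, C_mul, C_0, neg_mul]
  ring

theorem lawDiagonal_eq_form (a : ℂ) : lawDiagonal a =
    form ![0, 0, 0, 3 * a, 0, 0, 0, 3 * a ^ 2, 0, a ^ 3] := by
  have h3 : (3 : MvPolynomial (Fin 3) ℂ) = C 3 := (map_ofNat C 3).symm
  rw [lawDiagonal, ← generalForm_eq_form, generalForm]
  simp only [C_mul, C_0, C_pow, ← h3]
  ring

end Axioms

/-! ### The law on the curve as a coset group -/

section Orbits

open WeierstrassCurve.Affine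

variable {c : ℂ}

instance : Finite (Subgroup.zpowers (rotateAut c)) :=
  (orderOf_pos_iff.1 (by rw [orderOf_rotateAut]; norm_num)).finite_zpowers.to_subtype

/-- The orbits of the group generated by the automorphism of order three. -/
abbrev Orbits (c : ℂ) : Type :=
  MulAction.orbitRel.Quotient (Subgroup.zpowers (rotateAut c)) (Multiplicative (curve c).Point)

/-- The orbit of a point. -/
def orbit (A : (curve c).Point) : Orbits c := Quotient.mk _ (Multiplicative.ofAdd A)

theorem invY_zpow_rotateAut (n : ℤ) (A : Multiplicative (curve c).Point) :
    invY c (Multiplicative.toAdd ((rotateAut c ^ n) A)) = invY c (Multiplicative.toAdd A) := by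
  induction n using Int.induction_on generalizing A with
  | zero => rfl
  | succ n ih =>
    rw [zpow_add_one, MulAut.mul_apply, ih]
    exact invY_rotate _
  | pred n ih =>
    rw [zpow_sub_one, MulAut.mul_apply, ih]
    conv_rhs => rw [← MulAut.apply_inv_self _ (rotateAut c) A]
    exact (invY_rotate _).symm

/-- The coordinate `1 / y` on the orbits. -/
def orbitCoord (c : ℂ) : Orbits c → OnePoint ℂ :=
  Quotient.lift (fun A => invY c (Multiplicative.toAdd A)) (by
    rintro A B ⟨⟨_, n, rfl⟩, rfl⟩
    exact invY_zpow_rotateAut n B)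

theorem orbitCoord_orbit (A : (curve c).Point) : orbitCoord c (orbit A) = invY c A := rfl

theorem orbit_rotate (A : (curve c).Point) : orbit (rotate A) = orbit A :=
  Quotient.sound ⟨⟨rotateAut c, Subgroup.mem_zpowers _⟩, rfl⟩

theorem exists_orbit (a : Orbits c) : ∃ A, a = orbit A := by
  induction a using Quotient.inductionOn with | _ A
  exact ⟨Multiplicative.toAdd A, rfl⟩

theorem invY_some_ne_zero {x y : ℂ} (h : (curve c).Nonsingular x y) :
    invY c (.some x y h) ≠ ((0 : ℂ) : OnePoint ℂ) := by
  rw [Ne, invY_some_eq_coe_iff]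
  rintro ⟨hy, h0⟩
  exact inv_ne_zero hy h0.symm

theorem orbitCoord_injective : Function.Injective (orbitCoord c) := by
  intro a b h
  obtain ⟨A, rfl⟩ := exists_orbit a
  obtain ⟨B, rfl⟩ := exists_orbit b
  rw [orbitCoord_orbit, orbitCoord_orbit] at h
  rcases A with _ | ⟨x₁, y₁, h₁⟩
  · rcases B with _ | ⟨x₂, y₂, h₂⟩
    · rfl
    · exact absurd h.symm (invY_some_ne_zero h₂)
  rcases B with _ | ⟨x₂, y₂, h₂⟩
  · exact absurd h (invY_some_ne_zero h₁)
  have hy : y₁ = y₂ := by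
    rw [invY_some, invY_some] at h
    split_ifs at h with h1 h2 h2
    · rw [h1, h2]
    · exact absurd h (OnePoint.infty_ne_coe _)
    · exact absurd h (OnePoint.coe_ne_infty _)
    · exact inv_injective (OnePoint.coe_injective h)
  subst hy
  have e₁ := (curve_nonsingular_iff.1 h₁).1
  have e₂ := (curve_nonsingular_iff.1 h₂).1
  have hx : x₁ ^ 3 = x₂ ^ 3 := by linear_combination e₂ - e₁
  rcases eq_omega_mul_of_pow_three_eq hx with rfl | rfl | rfl
  · rfl
  · exact orbit_rotate (.some x₂ y₁ h₂)
  · exact (orbit_rotate (rotate (.some x₂ y₁ h₂))).trans (orbit_rotate _)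

theorem range_orbitCoord :
    Set.range (orbitCoord c) = {p : OnePoint ℂ | p = OnePoint.infty → c ≠ 0} := by
  ext p
  constructor
  · rintro ⟨a, rfl⟩ h rfl
    obtain ⟨A, rfl⟩ := exists_orbit a
    rw [orbitCoord_orbit] at h
    rcases A with _ | ⟨x, y, hA⟩
    · exact OnePoint.coe_ne_infty _ h
    · rw [invY_some] at h
      split_ifs at h with hy
      · have := curve_nonsingular_iff.1 hA
        rw [hy] at this
        have h0 : x ^ 3 = 0 := by linear_combination -this.1
        simp at h0
        simp [h0] at this
      · exact OnePoint.coe_ne_infty _ h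
  · intro hp
    have hpt : ∀ y : ℂ, (y = 0 → c ≠ 0) → ∃ x, (curve c).Nonsingular x y := fun y hy => by
      obtain ⟨x, hx⟩ := IsAlgClosed.exists_pow_nat_eq (y ^ 2 - c) (n := 3) (by norm_num)
      refine ⟨x, curve_nonsingular_iff.2 ⟨by rw [hx]; ring, ?_⟩⟩
      by_contra! h
      rw [h.1, h.2] at hx
      exact hy h.2 (by linear_combination hx)
    induction p with
    | infty =>
      obtain ⟨x, hx⟩ := hpt 0 fun _ => hp rfl
      exact ⟨orbit (.some x 0 hx), by rw [orbitCoord_orbit, invY_some, if_pos rfl]⟩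
    | coe u =>
      by_cases hu : u = 0
      · exact ⟨orbit 0, by rw [orbitCoord_orbit, invY_zero, hu]⟩
      · obtain ⟨x, hx⟩ := hpt u⁻¹ fun h => absurd h (inv_ne_zero hu)
        exact ⟨orbit (.some x u⁻¹ hx), by
          rw [orbitCoord_orbit, invY_some, if_neg (inv_ne_zero hu), inv_inv]⟩

theorem map_orbitCoord_cosetMul (A B : (curve c).Point) :
    (cosetMul (Subgroup.zpowers (rotateAut c)) (orbit A) (orbit B)).map (orbitCoord c) =
      {invY c (A + B), invY c (A + rotate B), invY c (A + rotate (rotate B))} := by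
  rw [orbit, orbit, cosetMul_zpowers (orderOf_rotateAut c)]
  rfl

theorem roots_of_eq_lin {q : Polynomial ℂ} {k : ℂ} (hk : k ≠ 0) {p₁ p₂ p₃ : OnePoint ℂ}
    (h : q = Polynomial.C k * (lin p₁ * lin p₂ * lin p₃)) :
    (q.coeff 3 ≠ 0 ↔ ∀ p ∈ ({p₁, p₂, p₃} : Multiset (OnePoint ℂ)), p ≠ OnePoint.infty) ∧
    (q.coeff 3 ≠ 0 → ({p₁, p₂, p₃} : Multiset (OnePoint ℂ)) =
      q.roots.map (fun w : ℂ => (w : OnePoint ℂ))) := by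
  have hl : ∀ p : OnePoint ℂ, ∃ a b : ℂ, lin p = Polynomial.C a * Polynomial.X + Polynomial.C b ∧
      (a ≠ 0 ↔ p ≠ OnePoint.infty) := fun p => by
    induction p with
    | infty => exact ⟨0, 1, by simp [lin_infty], by simp⟩
    | coe w => exact ⟨1, -w, by simp [lin_coe, sub_eq_add_neg], by simp⟩
  have hiff : q.coeff 3 ≠ 0 ↔
      ∀ p ∈ ({p₁, p₂, p₃} : Multiset (OnePoint ℂ)), p ≠ OnePoint.infty := by
    obtain ⟨a₁, b₁, e₁, h₁⟩ := hl p₁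
    obtain ⟨a₂, b₂, e₂, h₂⟩ := hl p₂
    obtain ⟨a₃, b₃, e₃, h₃⟩ := hl p₃
    have : q = Polynomial.C (k * (b₁ * b₂ * b₃))
        + Polynomial.C (k * (a₁ * b₂ * b₃ + a₂ * b₁ * b₃ + a₃ * b₁ * b₂)) * Polynomial.X
        + Polynomial.C (k * (a₁ * a₂ * b₃ + a₁ * a₃ * b₂ + a₂ * a₃ * b₁)) * Polynomial.X ^ 2
        + Polynomial.C (k * (a₁ * a₂ * a₃)) * Polynomial.X ^ 3 := by
      rw [h, e₁, e₂, e₃]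
      simp only [map_mul, map_add]
      ring
    have hc : q.coeff 3 = k * (a₁ * a₂ * a₃) := by
      rw [this]
      simp only [Polynomial.coeff_add, Polynomial.coeff_C_mul, Polynomial.coeff_X_pow,
        Polynomial.coeff_X, Polynomial.coeff_C]
      norm_num
    rw [hc]
    simp [hk, ← h₁, ← h₂, ← h₃, and_assoc]
  refine ⟨hiff, fun h3 => ?_⟩
  have hp := hiff.1 h3
  obtain ⟨a, rfl⟩ := OnePoint.ne_infty_iff_exists.1 (hp p₁ (by simp))
  obtain ⟨b, rfl⟩ := OnePoint.ne_infty_iff_exists.1 (hp p₂ (by simp))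
  obtain ⟨d, rfl⟩ := OnePoint.ne_infty_iff_exists.1 (hp p₃ (by simp))
  have : (({a, b, d} : Multiset ℂ).map fun w => Polynomial.X - Polynomial.C w).prod =
      lin a * lin b * lin d := by
    simp [lin_coe, mul_assoc]
  rw [h, ← this, Polynomial.roots_C_mul _ hk, Polynomial.roots_multiset_prod_X_sub_C]
  simp

theorem cosetMul_elliptic {P : MvPolynomial (Fin 3) ℂ} (hP : twist 3 P = lawElliptic c)
    {a b : Orbits c} {u v : ℂ} (ha : orbitCoord c a = (u : OnePoint ℂ))
    (hb : orbitCoord c b = (v : OnePoint ℂ)) :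
    (F 3 P 0 u v ≠ 0 ↔ ∀ w ∈ cosetMul (Subgroup.zpowers (rotateAut c)) a b,
      orbitCoord c w ≠ OnePoint.infty) ∧
    (F 3 P 0 u v ≠ 0 →
      (cosetMul (Subgroup.zpowers (rotateAut c)) a b).map (orbitCoord c) =
        (rootMul P u v).map (fun w : ℂ => (w : OnePoint ℂ))) := by
  obtain ⟨A, rfl⟩ := exists_orbit a
  obtain ⟨B, rfl⟩ := exists_orbit b
  obtain ⟨k, hk, h⟩ := factors A B P hP u v ha hb
  have hq : slice P u v = Polynomial.C k * (lin (invY c (A + B)) * lin (invY c (A + rotate B)) *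
      lin (invY c (A + rotate (rotate B)))) := Polynomial.funext fun z => by
    rw [h]
    simp
  have := roots_of_eq_lin hk hq
  rw [← map_orbitCoord_cosetMul] at this
  simpa [F, rootMul, Multiset.mem_map] using this

theorem isSymmetricAlgebraicGroup_elliptic {P : MvPolynomial (Fin 3) ℂ}
    (hP : twist 3 P = lawElliptic c) : IsSymmetricAlgebraicGroup 3 P := by
  refine isSymmetricAlgebraicGroup_of_assoc (hP.trans (lawElliptic_eq_form c))
    fun x y z hxy hyz hxyz hyzx => ?_
  have hex : ∀ u : ℂ, ∃ a, orbitCoord c a = (u : OnePoint ℂ) := fun u => by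
    have : (u : OnePoint ℂ) ∈ Set.range (orbitCoord c) := by
      rw [range_orbitCoord]
      exact fun h => absurd h (OnePoint.coe_ne_infty u)
    exact this
  obtain ⟨a, ha⟩ := hex x
  obtain ⟨b, hb⟩ := hex y
  obtain ⟨d, hd⟩ := hex z
  have hab := (cosetMul_elliptic hP ha hb).2 hxy
  have hbd := (cosetMul_elliptic hP hb hd).2 hyz
  have aux : ∀ (s : Multiset (Orbits c)) (r : Multiset ℂ) (f : Orbits c → Multiset (Orbits c))
      (g : ℂ → Multiset ℂ), s.map (orbitCoord c) = r.map (fun w : ℂ => (w : OnePoint ℂ)) →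
      (∀ e w, w ∈ r → orbitCoord c e = (w : OnePoint ℂ) →
        (f e).map (orbitCoord c) = (g w).map (fun w : ℂ => (w : OnePoint ℂ))) →
      (s.bind f).map (orbitCoord c) = (r.bind g).map (fun w : ℂ => (w : OnePoint ℂ)) := by
    intro s r f g hsr hfg
    have h1 : s.bind (fun e => (f e).map (orbitCoord c)) =
        (s.map (orbitCoord c)).bind
          (fun p => p.elim 0 fun w => (g w).map (fun w : ℂ => (w : OnePoint ℂ))) := by
      rw [Multiset.bind_map]
      refine Multiset.bind_congr fun e he => ?_
      have hm : orbitCoord c e ∈ s.map (orbitCoord c) := Multiset.mem_map_of_mem _ he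
      rw [hsr, Multiset.mem_map] at hm
      obtain ⟨w, hw, hwe⟩ := hm
      rw [hfg e w hw hwe.symm, ← hwe]
      rfl
    rw [Multiset.map_bind, h1, hsr, Multiset.bind_map, Multiset.map_bind]
    rfl
  have h1 := aux _ _ (fun e => cosetMul _ e d) (fun w => rootMul P w z) hab
    fun e w hw he => (cosetMul_elliptic hP he hd).2 (hxyz w hw)
  have h2 := aux _ _ (fun e => cosetMul _ a e) (fun w => rootMul P x w) hbd
    fun e w hw he => (cosetMul_elliptic hP ha he).2 (hyzx w hw)
  rw [cosetMul_assoc, h2] at h1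
  exact (Multiset.map_injective OnePoint.coe_injective h1).symm

end Orbits

/-! ### Homogeneous components -/

section Homogeneous

theorem isHomogeneous_sigma (i : ℕ) : (σ i).IsHomogeneous i := by
  refine IsHomogeneous.sum _ _ _ fun s hs => ?_
  have := IsHomogeneous.prod s (fun j : Fin 3 => (X j : MvPolynomial (Fin 3) ℂ)) (fun _ => 1)
    fun j _ => isHomogeneous_X ℂ j
  rwa [Finset.sum_const, (Finset.mem_powersetCard.1 hs).2, smul_eq_mul, mul_one] at this

theorem homogeneousComponent_C_mul_of_ne {p : MvPolynomial (Fin 3) ℂ} {m n : ℕ}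
    (hp : p.IsHomogeneous m) (h : m ≠ n) (a : ℂ) : homogeneousComponent n (C a * p) = 0 := by
  have := (isHomogeneous_C (Fin 3) a).mul hp
  rw [zero_add] at this
  rw [homogeneousComponent_of_mem this, if_neg h.symm]

theorem homogeneousComponent_form (κ : Fin 10 → ℂ) :
    homogeneousComponent 3 (form κ) = σ 1 ^ 3 + C (κ 0) * σ 3 := by
  have h1 := isHomogeneous_sigma 1
  have h2 := isHomogeneous_sigma 2
  have h3 := isHomogeneous_sigma 3
  simp only [form, generalForm, map_add, mul_assoc]
  rw [homogeneousComponent_C_mul_of_ne (h3.pow 2) (by norm_num),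
    homogeneousComponent_C_mul_of_ne (h3.pow 3) (by norm_num),
    homogeneousComponent_C_mul_of_ne (h1.mul h3) (by norm_num),
    homogeneousComponent_C_mul_of_ne (h2.mul h3) (by norm_num),
    homogeneousComponent_C_mul_of_ne (h1.mul (h2.mul h3)) (by norm_num),
    homogeneousComponent_C_mul_of_ne ((h1.pow 2).mul h3) (by norm_num),
    homogeneousComponent_C_mul_of_ne ((h2.pow 2).mul h3) (by norm_num),
    homogeneousComponent_C_mul_of_ne ((h3.pow 2).mul h1) (by norm_num),
    homogeneousComponent_C_mul_of_ne ((h3.pow 2).mul h2) (by norm_num),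
    homogeneousComponent_of_mem (h1.pow 3), if_pos (by norm_num), homogeneousComponent_C_mul,
    homogeneousComponent_of_mem h3, if_pos rfl]
  simp only [add_zero]

theorem cubes_eq (a b z : ℂ) :
    (z - (a + omega * b) ^ 3) * (z - (a + omega ^ 2 * b) ^ 3) * (z - (a + omega ^ 3 * b) ^ 3) =
      (z - a ^ 3 - b ^ 3) ^ 3 - 27 * (a ^ 3 * b ^ 3 * z) := by
  have h1 : (a + omega * b) ^ 3 =
      a ^ 3 + b ^ 3 + 3 * omega * a ^ 2 * b - 3 * (1 + omega) * a * b ^ 2 := by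
    linear_combination b ^ 3 * omega_pow_three + 3 * a * b ^ 2 * omega_sq
  have h2 : (a + omega ^ 2 * b) ^ 3 =
      a ^ 3 + b ^ 3 - 3 * (1 + omega) * a ^ 2 * b + 3 * omega * a * b ^ 2 := by
    linear_combination (b ^ 3 * (omega ^ 3 + 1) + 3 * a * b ^ 2 * omega) * omega_pow_three
      + 3 * a ^ 2 * b * omega_sq
  rw [h1, h2, omega_pow_three, one_mul]
  linear_combination 9 * a ^ 2 * b ^ 2 * (2 * a * b - a ^ 2 - b ^ 2) * (z - (a + b) ^ 3) * omega_sq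

theorem rootMul_cubes {H : MvPolynomial (Fin 3) ℂ} (hH : twist 3 H = σ 1 ^ 3 - 27 * σ 3)
    (x y : ℂ) : F 3 H 0 x y ≠ 0 ∧ rootMul H x y = groupGMul 3 x y := by
  have hf : twist 3 H = form ![-27, 0, 0, 0, 0, 0, 0, 0, 0, 0] := by
    have h27 : (27 : MvPolynomial (Fin 3) ℂ) = C 27 := (map_ofNat C 27).symm
    rw [hH, ← generalForm_eq_form, generalForm, h27]
    simp only [C_neg, C_0]
    ring
  refine ⟨by rw [F_zero_eq hf]; simp [gf₃], ?_⟩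
  have hr : groupGMul 3 x y = {(x ^ (1 / 3 : ℂ) + omega * y ^ (1 / 3 : ℂ)) ^ 3,
      (x ^ (1 / 3 : ℂ) + omega ^ 2 * y ^ (1 / 3 : ℂ)) ^ 3,
      (x ^ (1 / 3 : ℂ) + omega ^ 3 * y ^ (1 / 3 : ℂ)) ^ 3} := by
    have : (Finset.Icc 1 3).val = ({1, 2, 3} : Multiset ℕ) := by decide
    rw [groupGMul, this]
    simp [omega]
  have hroot : ∀ x : ℂ, (x ^ (1 / 3 : ℂ)) ^ 3 = x := fun x => by
    rw [one_div]
    exact Complex.cpow_ofNat_inv_pow x 3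
  have hs : slice H x y =
      ((groupGMul 3 x y).map fun w => Polynomial.X - Polynomial.C w).prod := by
    refine Polynomial.funext fun z => ?_
    rw [hr]
    have := cubes_eq (x ^ (1 / 3 : ℂ)) (y ^ (1 / 3 : ℂ)) z
    rw [hroot, hroot] at this
    rw [slice_eq hf]
    simp only [Multiset.insert_eq_cons, Multiset.map_cons, Multiset.map_singleton,
      Multiset.prod_cons, Multiset.prod_singleton, Polynomial.eval_mul, Polynomial.eval_sub,
      Polynomial.eval_add, Polynomial.eval_pow, Polynomial.eval_X, Polynomial.eval_C]
    rw [← mul_assoc, this]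
    simp [gf₀, gf₁, gf₂, gf₃]
    ring
  rw [rootMul, hs, Polynomial.roots_multiset_prod_X_sub_C]

end Homogeneous

/-! ### The diagonal law -/

section Diagonal

variable {α : ℂ} {P Q : MvPolynomial (Fin 3) ℂ}

theorem slice_rational (hQ : twist 1 Q = σ 1 + C α * σ 3) (x y : ℂ) :
    slice Q x y = Polynomial.C (1 + α * x * y) * Polynomial.X + Polynomial.C (-(x + y)) := by
  refine Polynomial.funext fun z => ?_
  rw [eval_slice_one, hQ, map_add, map_mul, eval_C, eval_sigma_one, eval_sigma_three]
  simp only [Polynomial.eval_add, Polynomial.eval_mul, Polynomial.eval_C, Polynomial.eval_X]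
  ring

theorem slice_diagonal (hP : twist 3 P = lawDiagonal α) (x y : ℂ) :
    slice P x y =
      (Polynomial.C (1 + α * x * y) * Polynomial.X + Polynomial.C (-(x + y))) ^ 3 := by
  refine Polynomial.funext fun z => ?_
  rw [eval_slice_three, hP, lawDiagonal, map_pow, map_add, map_mul, eval_C, eval_sigma_one,
    eval_sigma_three]
  simp only [Polynomial.eval_add, Polynomial.eval_mul, Polynomial.eval_C, Polynomial.eval_X,
    Polynomial.eval_pow]
  ring

theorem F_rational (hQ : twist 1 Q = σ 1 + C α * σ 3) (x y : ℂ) :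
    F 1 Q 0 x y = 1 + α * x * y := by
  rw [F, slice_rational hQ]
  simp [Polynomial.coeff_C]

theorem F_diagonal (hP : twist 3 P = lawDiagonal α) (x y : ℂ) :
    F 3 P 0 x y = (1 + α * x * y) ^ 3 := by
  rw [F_zero_eq (hP.trans (lawDiagonal_eq_form α))]
  simp [gf₃]
  ring

theorem roots_linear {a b : ℂ} (ha : a ≠ 0) :
    (Polynomial.C a * Polynomial.X + Polynomial.C (-b)).roots = {b / a} := by
  rw [Polynomial.roots_C_mul_X_add_C _ ha, mul_neg, neg_neg, inv_mul_eq_div]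

theorem rootMul_rational (hQ : twist 1 Q = σ 1 + C α * σ 3) {x y : ℂ} (h : 1 + α * x * y ≠ 0) :
    rootMul Q x y = {(x + y) / (1 + α * x * y)} := by
  rw [rootMul, slice_rational hQ, roots_linear h]

theorem rootMul_diagonal (hP : twist 3 P = lawDiagonal α) {x y : ℂ} (h : 1 + α * x * y ≠ 0) :
    rootMul P x y = Multiset.replicate 3 ((x + y) / (1 + α * x * y)) := by
  rw [rootMul, slice_diagonal hP, Polynomial.roots_pow, roots_linear h, Multiset.nsmul_singleton]

theorem rational_assoc {x y z : ℂ} (hxy : 1 + α * x * y ≠ 0) (hyz : 1 + α * y * z ≠ 0)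
    (h : 1 + α * ((x + y) / (1 + α * x * y)) * z ≠ 0)
    (h' : 1 + α * x * ((y + z) / (1 + α * y * z)) ≠ 0) :
    ((x + y) / (1 + α * x * y) + z) / (1 + α * ((x + y) / (1 + α * x * y)) * z) =
      (x + (y + z) / (1 + α * y * z)) / (1 + α * x * ((y + z) / (1 + α * y * z))) := by
  rw [div_eq_div_iff h h']
  obtain ⟨a, ha⟩ : ∃ a, a = 1 + α * x * y := ⟨_, rfl⟩
  obtain ⟨b, hb⟩ : ∃ b, b = 1 + α * y * z := ⟨_, rfl⟩
  rw [← ha] at hxy ⊢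
  rw [← hb] at hyz ⊢
  field_simp
  rw [ha, hb]
  ring

theorem isSymmetricAlgebraicGroup_diagonal (hP : twist 3 P = lawDiagonal α) :
    IsSymmetricAlgebraicGroup 3 P := by
  refine isSymmetricAlgebraicGroup_of_assoc (hP.trans (lawDiagonal_eq_form α))
    fun x y z hxy hyz h h' => ?_
  have hF : ∀ {x y : ℂ}, F 3 P 0 x y ≠ 0 → 1 + α * x * y ≠ 0 := fun {x y} h hc => by
    rw [F_diagonal hP, hc] at h
    simp at h
  rw [rootMul_diagonal hP (hF hxy)] at h ⊢
  rw [rootMul_diagonal hP (hF hyz)] at h' ⊢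
  have h1 := hF (h ((x + y) / (1 + α * x * y)) (by simp))
  have h2 := hF (h' ((y + z) / (1 + α * y * z)) (by simp))
  have aux : ∀ (w : ℂ) (g : ℂ → Multiset ℂ), (Multiset.replicate 3 w).bind g = 3 • g w :=
    fun w g => by simp [Multiset.replicate_succ, succ_nsmul, add_assoc]
  rw [aux, aux, rootMul_diagonal hP h1, rootMul_diagonal hP h2,
    rational_assoc (hF hxy) (hF hyz) h1 h2]

theorem isSymmetricAlgebraicGroup_rational (hQ : twist 1 Q = σ 1 + C α * σ 3) :
    IsSymmetricAlgebraicGroup 1 Q := by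
  refine ⟨⟨fun i => ?_, ?_, fun y => ?_, fun x => ?_, ⟨-Polynomial.X, fun x => ?_⟩,
    fun x y z hxy hyz h h' => ?_⟩, ?_⟩
  · rw [← degreeOf_twist 1, hQ]
    have hX : ∀ j : Fin 3, degreeOf i (X j : MvPolynomial (Fin 3) ℂ) = if i = j then 1 else 0 :=
      fun j => by rw [degreeOf_X]
    refine (degreeOf_add_le _ _ _).trans (max_le ?_ ?_)
    · rw [sigma_one]
      refine (degreeOf_add_le _ _ _).trans (max_le ((degreeOf_add_le _ _ _).trans (max_le ?_ ?_))
        ?_) <;> rw [hX] <;> split_ifs <;> norm_num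
    · refine (degreeOf_C_mul_le _ _ _).trans ?_
      rw [sigma_three]
      refine (degreeOf_mul_le _ _ _).trans ((add_le_add_left (degreeOf_mul_le _ _ _) _).trans ?_)
      rw [hX, hX, hX]
      fin_cases i <;> simp
  · rw [F_rational hQ]
    ring
  · rw [slice_rational hQ, F_rational hQ]
    simp [sub_eq_add_neg]
  · rw [slice_rational hQ, F_rational hQ]
    simp [sub_eq_add_neg]
  · rw [F, F, slice_rational hQ, slice_rational hQ]
    simp
  · rw [F_rational hQ] at hxy hyz
    rw [rootMul_rational hQ hxy] at h ⊢
    rw [rootMul_rational hQ hyz] at h' ⊢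
    have h1 := h _ (Multiset.mem_singleton_self _)
    have h2 := h' _ (Multiset.mem_singleton_self _)
    rw [F_rational hQ] at h1 h2
    rw [Multiset.singleton_bind, Multiset.singleton_bind, rootMul_rational hQ h1,
      rootMul_rational hQ h2, rational_assoc hxy hyz h1 h2]
  · intro e
    have h : ∀ i, rename e (σ i) = σ i := fun i => rename_esymm (Fin 3) ℂ i e
    rw [hQ, map_add, map_mul, rename_C, h, h]

end Diagonal

end NValued

end

theorem mainTheorem8 :
    -- the general form of a symmetric 3-algebraic 3-valued group
    (∀ P : MvPolynomial (Fin 3) ℂ, NValued.IsSymmetricAlgebraicGroup 3 P →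
      ∃ k₀ k₂ k₄ k₆ k₈ k₁₀ k₁₂ l₄ l₆ l₈ : ℂ,
        NValued.twist 3 P = NValued.generalForm k₀ k₂ k₄ k₆ k₈ k₁₀ k₁₂ l₄ l₆ l₈) ∧
    -- there are exactly two classes, `k₀ = -27` and `k₀ = 0`
    (∀ (P : MvPolynomial (Fin 3) ℂ) (k₀ k₂ k₄ k₆ k₈ k₁₀ k₁₂ l₄ l₆ l₈ : ℂ),
      NValued.twist 3 P = NValued.generalForm k₀ k₂ k₄ k₆ k₈ k₁₀ k₁₂ l₄ l₆ l₈ →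
        (NValued.IsSymmetricAlgebraicGroup 3 P → k₀ = -27 ∨ k₀ = 0) ∧
        (k₀ = -27 → (NValued.IsSymmetricAlgebraicGroup 3 P ↔
          ∃ c : ℂ, NValued.twist 3 P = NValued.lawElliptic c)) ∧
        (k₀ = 0 → (NValued.IsSymmetricAlgebraicGroup 3 P ↔
          ∃ α : ℂ, NValued.twist 3 P = NValued.lawDiagonal α))) ∧
    -- the first class
    (∀ (c : ℂ) (P : MvPolynomial (Fin 3) ℂ), NValued.twist 3 P = NValued.lawElliptic c →
      NValued.IsSymmetricAlgebraicGroup 3 P ∧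
      -- the homogeneous component is the law of the group `𝔾₃`
      NValued.twist 3 (MvPolynomial.homogeneousComponent 3 P) =
        NValued.σ 1 ^ 3 - 27 * NValued.σ 3 ∧
      (∀ x y : ℂ, NValued.F 3 (MvPolynomial.homogeneousComponent 3 P) 0 x y ≠ 0 ∧
        NValued.rootMul (MvPolynomial.homogeneousComponent 3 P) x y =
          NValued.groupGMul 3 x y) ∧
      -- the law is that of the coset group of the curve `y² = x³ + c` by an automorphism `τ`
      -- of order 3, in the coordinate `1 / y` on the orbit space
      (∃ (τ : MulAut (Multiplicative (NValued.curve c).Point))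
          (_ : Finite (Subgroup.zpowers τ))
          (ψ : MulAction.orbitRel.Quotient (Subgroup.zpowers τ)
            (Multiplicative (NValued.curve c).Point) → OnePoint ℂ),
        orderOf τ = 3 ∧
        (∀ (x y : ℂ) (h : (NValued.curve c).Nonsingular x y),
          ∃ h' : (NValued.curve c).Nonsingular
              (Complex.exp (2 * Real.pi * Complex.I / 3) * x) y,
            τ (Multiplicative.ofAdd (WeierstrassCurve.Affine.Point.some x y h)) =
              Multiplicative.ofAdd (WeierstrassCurve.Affine.Point.some
                (Complex.exp (2 * Real.pi * Complex.I / 3) * x) y h')) ∧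
        (∀ A : (NValued.curve c).Point,
          ψ (Quotient.mk _ (Multiplicative.ofAdd A)) = NValued.invY c A) ∧
        Function.Injective ψ ∧
        Set.range ψ = {p : OnePoint ℂ | p = OnePoint.infty → c ≠ 0} ∧
        ∀ (a b : MulAction.orbitRel.Quotient (Subgroup.zpowers τ)
            (Multiplicative (NValued.curve c).Point)) (u v : ℂ),
          ψ a = (u : OnePoint ℂ) → ψ b = (v : OnePoint ℂ) →
            (NValued.F 3 P 0 u v ≠ 0 ↔
              ∀ w ∈ NValued.cosetMul (Subgroup.zpowers τ) a b, ψ w ≠ OnePoint.infty) ∧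
            (NValued.F 3 P 0 u v ≠ 0 →
              (NValued.cosetMul (Subgroup.zpowers τ) a b).map ψ =
                (NValued.rootMul P u v).map (fun w : ℂ => (w : OnePoint ℂ))))) ∧
    -- the second class
    (∀ (α : ℂ) (P : MvPolynomial (Fin 3) ℂ), NValued.twist 3 P = NValued.lawDiagonal α →
      NValued.IsSymmetricAlgebraicGroup 3 P ∧
      NValued.twist 3 (MvPolynomial.homogeneousComponent 3 P) = NValued.σ 1 ^ 3 ∧
      -- the law is the diagonal of the 1-algebraic 1-valued group with law `σ₁ + α σ₃`
      (∀ Q : MvPolynomial (Fin 3) ℂ,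
        NValued.twist 1 Q = NValued.σ 1 + MvPolynomial.C α * NValued.σ 3 →
          NValued.IsSymmetricAlgebraicGroup 1 Q ∧
          ∀ x y : ℂ, (NValued.F 3 P 0 x y ≠ 0 ↔ NValued.F 1 Q 0 x y ≠ 0) ∧
            (NValued.F 1 Q 0 x y ≠ 0 →
              NValued.rootMul Q x y = {(x + y) / (1 + α * x * y)} ∧
              NValued.rootMul P x y =
                (NValued.rootMul Q x y).bind (fun w => Multiset.replicate 3 w)))) := by
  open NValued in
  refine ⟨fun P => exists_form, ?_, ?_, ?_⟩
  · intro P k₀ k₂ k₄ k₆ k₈ k₁₀ k₁₂ l₄ l₆ l₈ hP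
    rw [generalForm_eq_form] at hP
    refine ⟨fun h => coeff_zero_cases hP h.1, ?_, ?_⟩
    · rintro rfl
      refine ⟨fun h => ?_, fun ⟨c, hc⟩ => isSymmetricAlgebraicGroup_elliptic hc⟩
      obtain ⟨c, hc⟩ := coeffs_of_elliptic hP h.1
      exact ⟨c, hc.trans (lawElliptic_eq_form c).symm⟩
    · rintro rfl
      refine ⟨fun h => ?_, fun ⟨a, ha⟩ => isSymmetricAlgebraicGroup_diagonal ha⟩
      obtain ⟨a, ha⟩ := coeffs_of_diagonal hP h.1
      exact ⟨a, ha.trans (lawDiagonal_eq_form a).symm⟩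
  · intro c P hP
    have hh : twist 3 (MvPolynomial.homogeneousComponent 3 P) = σ 1 ^ 3 - 27 * σ 3 := by
      have h27 : (27 : MvPolynomial (Fin 3) ℂ) = MvPolynomial.C 27 :=
        (map_ofNat MvPolynomial.C 27).symm
      rw [homogeneousComponent_twist, hP, lawElliptic_eq_form, homogeneousComponent_form,
        Matrix.cons_val_zero, MvPolynomial.C_neg, h27]
      ring
    refine ⟨isSymmetricAlgebraicGroup_elliptic hP, hh, rootMul_cubes hh,
      rotateAut c, inferInstance, orbitCoord c, orderOf_rotateAut c,
      fun x y h => ⟨omega_mul_nonsingular h, rfl⟩, fun A => rfl, orbitCoord_injective,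
      range_orbitCoord, fun a b u v ha hb => cosetMul_elliptic hP ha hb⟩
  · intro α P hP
    refine ⟨isSymmetricAlgebraicGroup_diagonal hP, ?_, fun Q hQ =>
      ⟨isSymmetricAlgebraicGroup_rational hQ, fun x y => ⟨?_, fun h => ?_⟩⟩⟩
    · rw [homogeneousComponent_twist, hP, lawDiagonal_eq_form, homogeneousComponent_form]
      simp
    · rw [F_diagonal hP, F_rational hQ]
      simp
    · rw [F_rational hQ] at h
      rw [rootMul_diagonal hP h, rootMul_rational hQ h, Multiset.singleton_bind]
      exact ⟨rfl, rfl⟩
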